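/- Let $M$ be a smooth Hausdorff manifold of dimension $n$ (without boundary), $TM\to M$ its tangent bundle, and let $\varphi : TM\times_M TM\to T(TM)$ be a connection on $M$, i.e. a smooth map such that for all $x\in M$ and $\xi,w\in T_xM$ the vector $\varphi(x)(\xi,w)$ lies in $T_w(TM)$ and is mapped to $\xi$ by the differential of the projection $TM\to M$. Let $PM$ be the space of smooth paths $\gamma:[0,1]\to M$, with tangent space $T_\gamma PM$ the space of smooth vector fields along $\gamma$, normed by the $C^1$ norm $\sup_t\max(|u(t)|,|u'(t)|)$ in charts of $M$ (if $\gamma$ is not contained in one chart, $[0,1]$ is covered by finitely many compact pieces, each mapped into a chart), and with the resulting manifold structure. Thus a curve $s\mapsto\Gamma(s)\in PM$ has velocity $V\in T_{\Gamma(s_0)}PM$ at $s_0$ if, for each chart $e$ of $M$ and each compact $K\subseteq[0,1]$ such that $\Gamma(s_0)(K)$ lies in the domain of $e$, also $\Gamma(s)(K)$ lies in that domain for $s$ close to $s_0$, and $e(\Gamma(s)(t))-e(\Gamma(s_0)(t))-(s-s_0)\,de(V(t))=o(|s-s_0|)$ in the $C^1$ norm over $t\in K$. The tangent bundle $T(PM)$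 is identified with the path space $P(TM)$, so that the tangent vectors of $T(PM)$ at $W\in T_\gamma PM$ are the smooth vector fields along the path $t\mapsto W(t)$ in $TM$. The induced connection on $PM$ is $\widetilde\varphi(V,W)(\gamma)(t)=\varphi(\gamma(t))(V(t),W(t))$ for $V,W\in T_\gamma PM$. A geodesic of it is a curve $\Gamma:[0,b]\to PM$ which has a velocity $\Gamma'(s)$ at every $s\in[0,b]$, whose velocity curve $\Gamma':[0,b]\to T(PM)$ has a velocity $\Gamma''(s)$ at every $s\in[0,b]$, and which satisfies $\widetilde\nabla_{\Gamma'}\Gamma'=\Gamma''-\widetilde\varphi(\Gamma',\Gamma')=0$ on $[0,b]$ (derivatives at the end points being one-sided). Then for every $\gamma\in PM$ and every $V\in T_\gamma PM$ there are $b>0$ and a geodesic $\Gamma:[0,b]\to PM$ of the induced connection with $\Gamma(0)=\gamma$ and $\Gamma'(0)=V$. It is unique: if $\Gamma_1:[0,b_1]\to PM$ and $\Gamma_2:[0,b_2]\to PM$, with $b_1,b_2>0$, are two geodesics with these initial data, then $\Gamma_1=\Gamma_2$ on $[0,\min(b_1,b_2)]$. -/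

import Mathlib

open Set Filter Topology Bundle
open scoped Manifold ContDiff ENNReal

noncomputable section

section PathSpaces

variable {E : Type*} [NormedAddCommGroup E] [NormedSpace ℝ E]
  {H : Type*} [TopologicalSpace H] (I : ModelWithCorners ℝ E H)
  (N : Type*) [TopologicalSpace N] [ChartedSpace H N]

/-- The path space `P N`: all smooth maps `[0,1] → N`, where `[0,1]` is the usual
manifold with boundary. -/
@[ext]
structure PathSpace where
  toFun : unitInterval → N
  smooth : ContMDiff (𝓡∂ 1) I ∞ toFun

variable {I N}

/-- The tangent space `T_γ (P N)`, that is, the space of smooth vector fields along `γ`. -/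
@[ext]
structure PathTangent [IsManifold I ∞ N] (γ : PathSpace I N) where
  toFun : ∀ t : unitInterval, TangentSpace I (γ.toFun t)
  smooth : ContMDiff (𝓡∂ 1) I.tangent ∞
    (fun t : unitInterval => (⟨γ.toFun t, toFun t⟩ : TangentBundle I N))

/-- The identification of the tangent bundle `T (P N) = ∐ γ, T_γ (P N)` with the path space
`P (T N)` of the tangent bundle: a smooth field `V` along `γ` is the smooth path
`t ↦ (γ t, V t)` in `T N`. In particular `T_V (T (P N))` consists of the smooth vector fields
along this path, with values in `T (T N)`. -/
def PathTangent.toPath [IsManifold I ∞ N] {γ : PathSpace I N} (V : PathTangent γ) :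
    PathSpace I.tangent (TangentBundle I N) :=
  ⟨fun t => ⟨γ.toFun t, V.toFun t⟩, V.smooth⟩

/-- The `C¹` norm `sup_{t ∈ K} max (|u t|, |u' t|)` of a function `u : [0,1] → E` over a set `K`
of parameters. The derivative is the derivative over `[0,1]`, one-sided at the end points.
The value lies in `[0,∞]`. -/
def c1NormOn (K : Set unitInterval) (u : unitInterval → E) : ℝ≥0∞ :=
  ⨆ t ∈ K, max ‖u t‖ₑ ‖derivWithin (IccExtend zero_le_one u) (Icc (0 : ℝ) 1) (t : ℝ)‖ₑ

/-- The coordinates in `E` of the field `V` in the chart of `N` at `x`, that is, `de (V t)` for the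
chart `e` (meaningful as long as `γ t` lies in the domain of `e`). -/
def PathTangent.inChart [IsManifold I ∞ N] {γ : PathSpace I N} (V : PathTangent γ) (x : N)
    (t : unitInterval) : E :=
  mfderiv I 𝓘(ℝ, E) (extChartAt I x) (γ.toFun t) (V.toFun t)

/-- Differentiability of curves in `P N`, for the manifold structure of `P N` whose model spaces
are the spaces `T_γ (P N)` with their `C¹` norm. That norm is computed by covering `γ` with
finitely many charts of `N`, each of them used over a compact set of parameters; so the condition
is stated over each compact set `K` of parameters which `Γ s₀` maps into the domain of a chart.

`HasPathVelocity Γ S s₀ V` says that the curve `Γ`, restricted to the parameter set `S`, has the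
velocity `V ∈ T_{Γ s₀} (P N)` at `s₀`: for such a chart `e` and such a `K`, the paths `Γ s` with
`s ∈ S` close to `s₀` map `K` into the domain of `e`, and
`e (Γ s t) - e (Γ s₀ t) - (s - s₀) • de (V t)` is `o (|s - s₀|)` in the `C¹` norm over `K`. -/
def HasPathVelocity [IsManifold I ∞ N] (Γ : ℝ → PathSpace I N) (S : Set ℝ) (s₀ : ℝ)
    (V : PathTangent (Γ s₀)) : Prop :=
  ∀ (x : N) (K : Set unitInterval), IsCompact K →
    (∀ t ∈ K, (Γ s₀).toFun t ∈ (extChartAt I x).source) →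
    (∀ᶠ s in 𝓝[S] s₀, ∀ t ∈ K, (Γ s).toFun t ∈ (extChartAt I x).source) ∧
    ∀ ε : ℝ, 0 < ε → ∀ᶠ s in 𝓝[S] s₀,
      c1NormOn K (fun t =>
        extChartAt I x ((Γ s).toFun t) - extChartAt I x ((Γ s₀).toFun t)
          - (s - s₀) • V.inChart x t)
        ≤ ENNReal.ofReal (ε * |s - s₀|)

end PathSpaces

section Connections

variable {E : Type*} [NormedAddCommGroup E] [NormedSpace ℝ E]
  {H : Type*} [TopologicalSpace H] (I : ModelWithCorners ℝ E H)
  (N : Type*) [TopologicalSpace N] [ChartedSpace H N] [IsManifold I ∞ N]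

/-- A connection on `N`: a smooth map `φ : TN ×_N TN → T (TN)` such that `φ (x) (ξ, w)`, for
`ξ, w ∈ T_x N`, is a tangent vector of `TN` at `w` which projects to `ξ` (the horizontal lift of
`ξ` at `w`). Linear connections are those for which `φ` is moreover linear in `ξ` and in `w`;
this is not required. -/
structure TangentConnection where
  toFun : ∀ (x : N) (_ξ w : TangentSpace I x),
    TangentSpace I.tangent (⟨x, w⟩ : TangentBundle I N)
  smooth : ContMDiff (I.prod 𝓘(ℝ, E × E)) I.tangent.tangent ∞
    (fun p : TotalSpace (E × E)
        ((TangentSpace I : N → Type _) ×ᵇ (TangentSpace I : N → Type _)) =>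
      (⟨⟨p.proj, p.snd.2⟩, toFun p.proj p.snd.1 p.snd.2⟩ :
        TangentBundle I.tangent (TangentBundle I N)))
  mfderiv_proj : ∀ (x : N) (ξ w : TangentSpace I x),
    mfderiv I.tangent I (fun p : TangentBundle I N => p.proj) ⟨x, w⟩ (toFun x ξ w) = ξ

variable {I N}

/-- Two smooth fields along a path form a smooth path in `TN ×_N TN`. -/
theorem PathTangent.contMDiff_prod {γ : PathSpace I N} (V W : PathTangent γ) :
    ContMDiff (𝓡∂ 1) (I.prod 𝓘(ℝ, E × E)) ∞
      (fun t : unitInterval => (⟨γ.toFun t, (V.toFun t, W.toFun t)⟩ :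
        TotalSpace (E × E)
          ((TangentSpace I : N → Type _) ×ᵇ (TangentSpace I : N → Type _)))) := by
  intro t
  have hV := contMDiffAt_totalSpace.1 (V.smooth t)
  have hW := contMDiffAt_totalSpace.1 (W.smooth t)
  rw [contMDiffAt_totalSpace]
  exact ⟨γ.smooth t, hV.2.prodMk_space hW.2⟩

/-- The induced connection on the path space: `(V, W) ↦ (t ↦ φ (γ t) (V t, W t))`, a tangent
vector of `T (P N)` at `W`, for `V, W ∈ T_γ (P N)`. -/
def TangentConnection.induced (φ : TangentConnection I N) {γ : PathSpace I N}
    (V W : PathTangent γ) : PathTangent W.toPath where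
  toFun t := φ.toFun (γ.toFun t) (V.toFun t) (W.toFun t)
  smooth := φ.smooth.comp (V.contMDiff_prod W)

/-- The covariant derivative of the induced connection in the direction `V ∈ T_γ (P N)`: if a
field takes the value `W` at `γ` and `dW` is its derivative in the direction `V`, a tangent vector
of `T (P N)` at `W`, then the covariant derivative is `dW - φ (V, W)`, computed pointwise. -/
def TangentConnection.inducedCov (φ : TangentConnection I N) {γ : PathSpace I N}
    (V W : PathTangent γ) (dW : PathTangent W.toPath) (t : unitInterval) :
    TangentSpace I.tangent (W.toPath.toFun t) :=
  dW.toFun t - (φ.induced V W).toFun t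

/-- `Γ : [0,b] → P N` is a geodesic of the induced connection with initial data `Γ 0 = γ` and
`Γ' 0 = V`: the curve `Γ` is differentiable with velocity `Γ'`, the velocity curve
`Γ' : [0,b] → T (P N)` is differentiable with velocity `Γ''`, and the covariant derivative of `Γ'`
in the direction `Γ'` vanishes. Only the values of `Γ` on `[0,b]` matter. -/
def IsPathGeodesic (φ : TangentConnection I N) (b : ℝ) (Γ : ℝ → PathSpace I N)
    (γ : PathSpace I N) (V : PathTangent γ) : Prop :=
  ∃ (Γ' : ∀ s : ℝ, PathTangent (Γ s)) (Γ'' : ∀ s : ℝ, PathTangent (Γ' s).toPath),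
    (∀ s ∈ Icc 0 b, HasPathVelocity Γ (Icc 0 b) s (Γ' s)) ∧
    (∀ s ∈ Icc 0 b, HasPathVelocity (fun σ => (Γ' σ).toPath) (Icc 0 b) s (Γ'' s)) ∧
    (∀ s ∈ Icc 0 b, ∀ t : unitInterval, φ.inducedCov (Γ' s) (Γ' s) (Γ'' s) t = 0) ∧
    (⟨Γ 0, Γ' 0⟩ : Σ α : PathSpace I N, PathTangent α) = ⟨γ, V⟩

end Connections

end

/-! In T(PM) = P(TM) the induced connection acts separately at each t. The geodesic equation
therefore says that for every t the curve s ↦ Γ'(s)(t) in TM is an integral curve of the geodesic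
field w ↦ φ(w, w). The smooth fields along γ with the C¹ norm are in general not complete, so the
ODE theorem on Banach spaces is not applied to PM; the equation is solved in the finite-dimensional
manifold TM, one t at a time, and the solutions are reassembled.

Existence: compactness of [0,1] gives one time ε for which the flow of the geodesic field exists
from every V(t) (`exists_flow_along_path`). The flow is jointly smooth, so the flowed paths are
smooth in t, and a second order Taylor estimate upgrades the velocity at each t to one in the C¹
norm over compact sets of parameters (`hasPathVelocity_of_locally_smooth`). Since φ(w, w) projects
to w, the flowed field is the velocity of its base path.

Smooth dependence of the flow on the initial point comes from the inverse function theorem applied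
to the integral equation on ℝ × E × C([0,1], E), where f acts by composition
(`exists_contDiffAt_flowEquation`).

Uniqueness: a velocity in PM gives a velocity at each t, and integral curves in the Hausdorff
manifold TM are determined by their initial value, also with one-sided derivatives at the end points
(`SolvesInChartsOn.eqOn_Icc`). -/

/-! ### Composition operators on spaces of continuous maps. -/

section Nemytskii

universe u
variable {K : Type*} [TopologicalSpace K] [CompactSpace K]

/-- Direct instances, since the general search is slow for spaces of operators. -/
noncomputable instance ContinuousMap.normedAddCommGroupCLM {E F : Type*} [NormedAddCommGroup E]
    [NormedSpace ℝ E] [NormedAddCommGroup F] [NormedSpace ℝ F] :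
    NormedAddCommGroup C(K, E →L[ℝ] F) := ContinuousMap.instNormedAddCommGroup

noncomputable instance ContinuousMap.normedSpaceCLM {E F : Type*} [NormedAddCommGroup E]
    [NormedSpace ℝ E] [NormedAddCommGroup F] [NormedSpace ℝ F] :
    NormedSpace ℝ C(K, E →L[ℝ] F) := ContinuousMap.normedSpace

/-- Pointwise application of a continuous family of operators, as a bilinear map. -/
noncomputable def ContinuousMap.applyₗ {E F : Type*} [NormedAddCommGroup E] [NormedSpace ℝ E]
    [NormedAddCommGroup F] [NormedSpace ℝ F] :
    C(K, E →L[ℝ] F) →ₗ[ℝ] C(K, E) →ₗ[ℝ] C(K, F) :=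
  LinearMap.mk₂ ℝ (fun A α => ⟨fun t => A t (α t), A.continuous.clm_apply α.continuous⟩)
    (fun A B α => by ext t; simp) (fun c A α => by ext t; simp)
    (fun A α β => by ext t; simp) (fun c A α => by ext t; simp)

/-- Pointwise application of a continuous family of operators, as a continuous bilinear map. -/
noncomputable def ContinuousMap.applyCLM {E F : Type*} [NormedAddCommGroup E] [NormedSpace ℝ E]
    [NormedAddCommGroup F] [NormedSpace ℝ F] :
    C(K, E →L[ℝ] F) →L[ℝ] C(K, E) →L[ℝ] C(K, F) :=
  LinearMap.mkContinuous₂ (E := C(K, E →L[ℝ] F)) (F := C(K, E)) (G := C(K, F))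
    (ContinuousMap.applyₗ (K := K) (E := E) (F := F)) 1
    (fun A α => by
      rw [ContinuousMap.norm_le _ (by positivity)]
      intro t
      rw [one_mul]
      exact (ContinuousLinearMap.le_opNorm (A t) (α t)).trans
        (mul_le_mul (A.norm_coe_le_norm t) (α.norm_coe_le_norm t) (norm_nonneg _) (norm_nonneg _)))

/-- First order Taylor remainders of a `C¹` map are locally uniformly small. -/
theorem ContDiffAt.eventually_norm_sub_sub_fderiv_le {E F : Type*} [NormedAddCommGroup E]
    [NormedSpace ℝ E] [NormedAddCommGroup F] [NormedSpace ℝ F] {f : E → F} {x : E}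
    (hf : ContDiffAt ℝ 1 f x) {c : ℝ} (hc : 0 < c) :
    ∀ᶠ p : E × E in 𝓝 (0, x), ‖f (p.2 + p.1) - f p.2 - fderiv ℝ f p.2 p.1‖ ≤ c * ‖p.1‖ := by
  -- One half of `c` bounds the remainder with the derivative frozen at `x`, the other half the
  -- change of the derivative between `x` and the base point.
  have h1 := (hf.hasStrictFDerivAt one_ne_zero).isLittleO.def (half_pos hc)
  have h2 : ∀ᶠ y in 𝓝 x, ‖fderiv ℝ f y - fderiv ℝ f x‖ ≤ c / 2 := by
    have h3 := (hf.fderiv_right (m := 0) (by norm_num)).continuousAt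
    filter_upwards [Metric.tendsto_nhds.1 h3 _ (half_pos hc)] with y hy
    rw [dist_eq_norm] at hy
    exact hy.le
  have t1 : Tendsto (fun p : E × E => (p.2 + p.1, p.2)) (𝓝 (0, x)) (𝓝 (x, x)) := by
    have : Continuous (fun p : E × E => (p.2 + p.1, p.2)) := by fun_prop
    simpa using this.tendsto (0, x)
  have t2 : Tendsto (fun p : E × E => p.2) (𝓝 (0, x)) (𝓝 x) := continuous_snd.tendsto (0, x)
  filter_upwards [t1.eventually h1, t2.eventually h2] with p h3 h4
  simp only [add_sub_cancel_left] at h3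
  have h5 : f (p.2 + p.1) - f p.2 - fderiv ℝ f p.2 p.1
      = (f (p.2 + p.1) - f p.2 - fderiv ℝ f x p.1) - (fderiv ℝ f p.2 - fderiv ℝ f x) p.1 := by
    simp only [sub_apply]; abel
  rw [h5]
  have h6 := (ContinuousLinearMap.le_opNorm (fderiv ℝ f p.2 - fderiv ℝ f x) p.1).trans
    (mul_le_mul_of_nonneg_right h4 (norm_nonneg _))
  linarith [norm_sub_le (f (p.2 + p.1) - f p.2 - fderiv ℝ f x p.1)
    ((fderiv ℝ f p.2 - fderiv ℝ f x) p.1)]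

/-- The composition operator `α ↦ f ∘ α` is differentiable on continuous maps. -/
theorem ContDiff.hasFDerivAt_continuousMap_comp {E F : Type*} [NormedAddCommGroup E]
    [NormedSpace ℝ E] [NormedAddCommGroup F] [NormedSpace ℝ F] {f : E → F} (hf : ContDiff ℝ 1 f)
    (α : C(K, E)) :
    HasFDerivAt (fun β : C(K, E) => (⟨f, hf.continuous⟩ : C(E, F)).comp β)
      (ContinuousMap.applyCLM
        ((⟨fderiv ℝ f, hf.continuous_fderiv one_ne_zero⟩ : C(E, E →L[ℝ] F)).comp α)) α := by
  rw [hasFDerivAt_iff_isLittleO_nhds_zero, Asymptotics.isLittleO_iff]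
  intro c hc
  -- Compactness of the range of `α` gives one `δ` for all base points `α t`, so the pointwise
  -- estimate becomes one in the sup norm.
  have h := (isCompact_range α.continuous).eventually_forall_of_forall_eventually
    (x₀ := (0 : E)) (P := fun h y => ‖f (y + h) - f y - fderiv ℝ f y h‖ ≤ c * ‖h‖)
    (fun y _ => hf.contDiffAt.eventually_norm_sub_sub_fderiv_le hc)
  obtain ⟨δ, hδ, h⟩ := Metric.eventually_nhds_iff.1 h
  filter_upwards [Metric.ball_mem_nhds (0 : C(K, E)) hδ] with β hβ
  rw [ContinuousMap.norm_le _ (by positivity)]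
  intro t
  have h1 : ‖β t‖ ≤ ‖β‖ := β.norm_coe_le_norm t
  have h2 := h (y := β t) (by
    rw [dist_zero_right]; exact h1.trans_lt (by simpa using hβ)) (α t) (mem_range_self t)
  exact h2.trans (mul_le_mul_of_nonneg_left h1 hc.le)

/-- Induction on `n`: the derivative of composition with `f` is composition with `fderiv ℝ f`
followed by the bounded linear map `applyCLM`. The target changes from `F` to `E →L[ℝ] F`, so the
induction ranges over `F`, and `E` and `F` share a universe. -/
theorem ContDiff.contDiff_continuousMap_comp_nat (n : ℕ) {E F : Type u} [NormedAddCommGroup E]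
    [NormedSpace ℝ E] [NormedAddCommGroup F] [NormedSpace ℝ F] {f : E → F} (hf : ContDiff ℝ ∞ f) :
    ContDiff ℝ n (fun β : C(K, E) => (⟨f, hf.continuous⟩ : C(E, F)).comp β) := by
  induction n generalizing F with
  | zero =>
    exact contDiff_zero.2 (ContinuousMap.continuous_postcomp _)
  | succ n ih =>
    rw [Nat.cast_succ, contDiff_succ_iff_hasFDerivAt]
    have h1 : ContDiff ℝ 1 f := hf.of_le (by exact_mod_cast le_top)
    refine ⟨_, ?_, fun α => h1.hasFDerivAt_continuousMap_comp α⟩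
    exact ContinuousMap.applyCLM.contDiff.comp
      (ih (f := fderiv ℝ f) (hf.fderiv_right (by simp)))

/-- The composition operator `α ↦ f ∘ α` is smooth on continuous maps. -/
theorem ContDiff.contDiff_continuousMap_comp {E F : Type u} [NormedAddCommGroup E]
    [NormedSpace ℝ E] [NormedAddCommGroup F] [NormedSpace ℝ F] {f : E → F} (hf : ContDiff ℝ ∞ f) :
    ContDiff ℝ ∞ (fun β : C(K, E) => (⟨f, hf.continuous⟩ : C(E, F)).comp β) :=
  contDiff_infty.2 fun n => hf.contDiff_continuousMap_comp_nat n

end Nemytskii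

/-! ### Smooth local flows on Banach spaces. -/

section Flow

variable {E : Type*} [NormedAddCommGroup E] [NormedSpace ℝ E]

/-- The Volterra operator `α ↦ (s ↦ ∫ τ in 0..s, α τ)` on `C([0,1], E)`. -/
noncomputable def volterra (E : Type*) [NormedAddCommGroup E] [NormedSpace ℝ E] :
    C(unitInterval, E) →L[ℝ] C(unitInterval, E) :=
  LinearMap.mkContinuous
    { toFun := fun α =>
        ⟨fun s => ∫ τ in (0 : ℝ)..s, IccExtend zero_le_one α τ,
          (intervalIntegral.continuous_primitive
            (fun a b => (α.continuous.Icc_extend' (h := zero_le_one)).intervalIntegrable a b) 0).comp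
            continuous_subtype_val⟩
      map_add' := fun α β => by
        ext s
        exact intervalIntegral.integral_add
          ((α.continuous.Icc_extend' (h := zero_le_one)).intervalIntegrable _ _)
          ((β.continuous.Icc_extend' (h := zero_le_one)).intervalIntegrable _ _)
      map_smul' := fun c α => by
        ext s
        exact intervalIntegral.integral_smul c _ } 1
    (fun α => by
      rw [ContinuousMap.norm_le _ (by positivity)]
      intro s
      have h := intervalIntegral.norm_integral_le_of_norm_le_const (a := 0) (b := (s : ℝ))
        (f := IccExtend zero_le_one α) (C := ‖α‖) (fun τ _ => α.norm_coe_le_norm _)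
      refine h.trans ?_
      rw [sub_zero, abs_of_nonneg s.2.1, one_mul]
      exact mul_le_of_le_one_right (norm_nonneg _) s.2.2)

theorem volterra_apply (α : C(unitInterval, E)) (s : unitInterval) :
    volterra E α s = ∫ τ in (0 : ℝ)..s, IccExtend zero_le_one α τ := rfl

/-- The map whose zeros in the last component are the solutions `α` on `[0,1]` of `α' = ε f(α)`,
`α 0 = y`. -/
noncomputable def flowEquation {f : E → E} (hf : ContDiff ℝ ∞ f)
    (p : ℝ × E × C(unitInterval, E)) : ℝ × E × C(unitInterval, E) :=
  (p.1, p.2.1, p.2.2 - ContinuousLinearMap.const ℝ unitInterval p.2.1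
    - p.1 • volterra E ((⟨f, hf.continuous⟩ : C(E, E)).comp p.2.2))

theorem contDiff_flowEquation {f : E → E} (hf : ContDiff ℝ ∞ f) :
    ContDiff ℝ ∞ (flowEquation hf) := by
  have h1 : ContDiff ℝ ∞ (fun p : ℝ × E × C(unitInterval, E) =>
      (⟨f, hf.continuous⟩ : C(E, E)).comp p.2.2) :=
    hf.contDiff_continuousMap_comp.comp (contDiff_snd.comp contDiff_snd)
  have h2 : ContDiff ℝ ∞ (fun p : ℝ × E × C(unitInterval, E) =>
      ContinuousLinearMap.const ℝ unitInterval p.2.1) :=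
    (ContinuousLinearMap.contDiff _).comp (contDiff_fst.comp contDiff_snd)
  refine contDiff_fst.prodMk ((contDiff_fst.comp contDiff_snd).prodMk ?_)
  exact ((contDiff_snd.comp contDiff_snd).sub h2).sub
    (contDiff_fst.smul ((volterra E).contDiff.comp h1))

/-- The linear equivalence `(a, b, c) ↦ (a, b, c - const b - a • g)`. -/
noncomputable def shearEquiv (g : C(unitInterval, E)) :
    (ℝ × E × C(unitInterval, E)) ≃L[ℝ] (ℝ × E × C(unitInterval, E)) :=
  ContinuousLinearEquiv.equivOfInverse
    ((ContinuousLinearMap.fst ℝ ℝ _).prod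
      (((ContinuousLinearMap.fst ℝ E _).comp (ContinuousLinearMap.snd ℝ ℝ _)).prod
        ((ContinuousLinearMap.snd ℝ E _).comp (ContinuousLinearMap.snd ℝ ℝ _)
          - (ContinuousLinearMap.const ℝ unitInterval).comp
            ((ContinuousLinearMap.fst ℝ E _).comp (ContinuousLinearMap.snd ℝ ℝ _))
          - (ContinuousLinearMap.fst ℝ ℝ _).smulRight g)))
    ((ContinuousLinearMap.fst ℝ ℝ _).prod
      (((ContinuousLinearMap.fst ℝ E _).comp (ContinuousLinearMap.snd ℝ ℝ _)).prod
        ((ContinuousLinearMap.snd ℝ E _).comp (ContinuousLinearMap.snd ℝ ℝ _)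
          + (ContinuousLinearMap.const ℝ unitInterval).comp
            ((ContinuousLinearMap.fst ℝ E _).comp (ContinuousLinearMap.snd ℝ ℝ _))
          + (ContinuousLinearMap.fst ℝ ℝ _).smulRight g)))
    (fun p => by ext <;> simp; abel) (fun p => by ext <;> simp; abel)

/-- At time scale 0 the nonlinear term has a nonzero derivative only in the direction of the scale.
The derivative is thus a shear, invertible whatever `f` is. -/
theorem hasFDerivAt_flowEquation {f : E → E} (hf : ContDiff ℝ ∞ f) (y : E)
    (α : C(unitInterval, E)) :
    HasFDerivAt (flowEquation hf)
      (shearEquiv (volterra E ((⟨f, hf.continuous⟩ : C(E, E)).comp α)) :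
        (ℝ × E × C(unitInterval, E)) →L[ℝ] (ℝ × E × C(unitInterval, E))) ((0 : ℝ), y, α) := by
  have h0 : HasFDerivAt (fun p : ℝ × E × C(unitInterval, E) => p.2.2)
      ((ContinuousLinearMap.snd ℝ E C(unitInterval, E)).comp (ContinuousLinearMap.snd ℝ ℝ _))
      (0, y, α) :=
    ((ContinuousLinearMap.snd ℝ E C(unitInterval, E)).comp
      (ContinuousLinearMap.snd ℝ ℝ _)).hasFDerivAt
  have h0' : HasFDerivAt (fun p : ℝ × E × C(unitInterval, E) => p.2.1)
      ((ContinuousLinearMap.fst ℝ E C(unitInterval, E)).comp (ContinuousLinearMap.snd ℝ ℝ _))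
      (0, y, α) :=
    ((ContinuousLinearMap.fst ℝ E C(unitInterval, E)).comp
      (ContinuousLinearMap.snd ℝ ℝ _)).hasFDerivAt
  have h1 := HasFDerivAt.comp (g := fun β : C(unitInterval, E) =>
      (⟨f, hf.continuous⟩ : C(E, E)).comp β) ((0 : ℝ), y, α)
    ((hf.of_le (by exact_mod_cast le_top)).hasFDerivAt_continuousMap_comp α) h0
  have h2 := (ContinuousLinearMap.const ℝ unitInterval (M := E)).hasFDerivAt.comp
    ((0 : ℝ), y, α) h0'
  have h3 := (hasFDerivAt_fst (𝕜 := ℝ) (p := ((0 : ℝ), y, α))).prodMk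
    (h0'.prodMk ((h0.sub h2).sub
    (hasFDerivAt_fst.smul ((volterra E).hasFDerivAt.comp ((0 : ℝ), y, α) h1))))
  refine h3.congr_fderiv ?_
  refine ContinuousLinearMap.ext fun p => ?_
  simp [shearEquiv]

end Flow

section Flow
variable {E : Type*} [NormedAddCommGroup E] [NormedSpace ℝ E]

/-- Solutions of the flow equation, for all data near `(0, y₀)`, form a smooth family of
continuous functions on `[0,1]`; the time parameter enters by rescaling. -/
theorem exists_contDiffAt_flowEquation [CompleteSpace E] {f : E → E} (hf : ContDiff ℝ ∞ f)
    (y₀ : E) :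
    ∃ δ > 0, ∃ A : ℝ × E → C(unitInterval, E), ∀ ε ∈ Ioo (-δ) δ, ∀ y ∈ Metric.ball y₀ δ,
      ContDiffAt ℝ ∞ A (ε, y) ∧
      (∀ s : unitInterval, A (ε, y) s =
        y + ε • ∫ τ in (0 : ℝ)..s, f (IccExtend zero_le_one (A (ε, y)) τ)) ∧
      ∀ s : unitInterval, A (ε, y) s = A (s * ε, y) 1 := by
  set G := flowEquation hf with hGdef
  set α₀ : C(unitInterval, E) := ContinuousMap.const _ y₀ with hα₀
  set p₀ : ℝ × E × C(unitInterval, E) := (0, y₀, α₀) with hp₀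
  have hGp₀ : G p₀ = (0, y₀, 0) := by
    simp only [hGdef, flowEquation, hp₀, zero_smul, sub_zero]
    congr 2
    ext s
    simp [hα₀]
  have hGd := hasFDerivAt_flowEquation hf y₀ α₀
  have hGs := (contDiff_flowEquation hf).contDiffAt.hasStrictFDerivAt' hGd (by simp)
  -- The equation keeps `ε` and `y` as components, so a local inverse on the slice `(ε, y, 0)`
  -- yields the solution with these data.
  set Θ := hGs.toOpenPartialHomeomorph G with hΘ
  have hΘG : ∀ p, Θ p = G p := fun p => rfl
  have hsrc : p₀ ∈ Θ.source := hGs.mem_toOpenPartialHomeomorph_source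
  have htgt : G p₀ ∈ Θ.target := Θ.map_source hsrc
  have hsymm : Θ.symm (G p₀) = p₀ := Θ.left_inv hsrc
  -- Smoothness of the inverse at a point needs an invertible derivative there; invertibility is an
  -- open condition, so it persists near `p₀`.
  have hgood : ∀ᶠ p in 𝓝 p₀, ∃ e : (ℝ × E × C(unitInterval, E)) ≃L[ℝ]
      (ℝ × E × C(unitInterval, E)),
      HasFDerivAt G (e : (ℝ × E × C(unitInterval, E)) →L[ℝ] (ℝ × E × C(unitInterval, E))) p := by
    have h1 : ContinuousAt (fderiv ℝ G) p₀ :=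
      ((contDiff_flowEquation hf).continuous_fderiv (by simp)).continuousAt
    have h2 := ContinuousLinearEquiv.nhds
      (shearEquiv (volterra E ((⟨f, hf.continuous⟩ : C(E, E)).comp α₀)))
    rw [← hGd.fderiv] at h2
    filter_upwards [h1 h2] with p hp
    obtain ⟨e, he⟩ := hp
    refine ⟨e, ?_⟩
    rw [he]
    exact ((contDiff_flowEquation hf).differentiable (by simp) p).hasFDerivAt
  obtain ⟨ρ, hρ, hρs⟩ := Metric.mem_nhds_iff.1 (Θ.open_source.mem_nhds hsrc)
  have hcont : Tendsto Θ.symm (𝓝 (G p₀)) (𝓝 p₀) := by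
    have := (Θ.continuousAt_symm htgt).tendsto
    rwa [hsymm] at this
  have hev := (hcont.eventually (hgood.and (Metric.ball_mem_nhds p₀ hρ))).and
    (Θ.open_target.mem_nhds htgt)
  rw [hGp₀] at hev
  obtain ⟨δ', hδ', hball⟩ := Metric.eventually_nhds_iff.1 hev
  have hq : ∀ ε ∈ Ioo (-(min δ' ρ)) (min δ' ρ), ∀ y ∈ Metric.ball y₀ (min δ' ρ),
      dist ((ε, y, 0) : ℝ × E × C(unitInterval, E)) (0, y₀, 0) < min δ' ρ := by
    intro ε hε y hy
    simp only [Prod.dist_eq, dist_self, max_lt_iff]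
    refine ⟨?_, hy, lt_min hδ' hρ⟩
    rw [Real.dist_eq, sub_zero]
    exact abs_lt.2 hε
  have hfst : ∀ q ∈ Θ.target, Θ.symm q = (q.1, q.2.1, (Θ.symm q).2.2) := by
    intro q hq
    have h : G (Θ.symm q) = q := Θ.right_inv hq
    refine Prod.ext ?_ (Prod.ext ?_ rfl)
    · exact congrArg (fun r => r.1) h
    · exact congrArg (fun r => r.2.1) h
  refine ⟨min δ' ρ, lt_min hδ' hρ, fun p => (Θ.symm (p.1, p.2, 0)).2.2, ?_⟩
  have hsol : ∀ ε ∈ Ioo (-(min δ' ρ)) (min δ' ρ), ∀ y ∈ Metric.ball y₀ (min δ' ρ),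
      ∀ s : unitInterval, (Θ.symm (ε, y, 0)).2.2 s =
        y + ε • ∫ τ in (0 : ℝ)..s, f (IccExtend zero_le_one (Θ.symm (ε, y, 0)).2.2 τ) := by
    intro ε hε y hy s
    obtain ⟨-, htg⟩ := hball ((hq ε hε y hy).trans_le (min_le_left _ _))
    have h : G (Θ.symm (ε, y, 0)) = (ε, y, 0) := Θ.right_inv htg
    rw [hfst _ htg] at h
    have h2 : _ - _ - _ = (0 : C(unitInterval, E)) := congrArg (fun r => r.2.2) h
    have h3 := congrArg (fun c : C(unitInterval, E) => c s) h2
    simp only [ContinuousMap.sub_apply, ContinuousMap.smul_apply, volterra_apply,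
      ContinuousMap.zero_apply] at h3
    rw [sub_sub, sub_eq_zero] at h3
    exact h3
  intro ε hε y hy
  obtain ⟨⟨⟨e, he⟩, hpb⟩, htg⟩ := hball ((hq ε hε y hy).trans_le (min_le_left _ _))
  refine ⟨?_, hsol ε hε y hy, ?_⟩
  · have h1 : ContDiffAt ℝ ∞ Θ.symm (ε, y, 0) :=
      Θ.contDiffAt_symm htg he (contDiff_flowEquation hf).contDiffAt
    have h2 : ContDiffAt ℝ ∞ (fun p : ℝ × E => ((p.1, p.2, 0) : ℝ × E × C(unitInterval, E)))
      (ε, y) := by fun_prop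
    exact contDiffAt_snd.comp _ (contDiffAt_snd.comp _
      (ContDiffAt.comp (g := Θ.symm) (ε, y) h1 h2))
  · intro s
    have hsε : (s : ℝ) * ε ∈ Ioo (-(min δ' ρ)) (min δ' ρ) := by
      rw [mem_Ioo, ← abs_lt, abs_mul, abs_of_nonneg s.2.1]
      exact (mul_le_of_le_one_left (abs_nonneg _) s.2.2).trans_lt (abs_lt.2 hε)
    obtain ⟨⟨-, hpb'⟩, htg'⟩ := hball ((hq _ hsε y hy).trans_le (min_le_left _ _))
    set α := (Θ.symm (ε, y, 0)).2.2 with hα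
    have hmul : ∀ τ : unitInterval, (s : ℝ) * τ ∈ unitInterval := fun τ =>
      unitInterval.mul_mem s.2 τ.2
    -- The rescaled solution `τ ↦ α (s τ)` solves the equation with scale `s ε`. It is no farther
    -- than `α` from the constant `α₀`, so it stays in the ball of radius `ρ` inside `Θ.source`,
    -- where injectivity identifies it with the solution already constructed.
    set β : C(unitInterval, E) := α.comp ⟨fun τ => s * τ, by fun_prop⟩ with hβ
    have hβmem : ((s : ℝ) * ε, y, β) ∈ Θ.source := by
      apply hρs
      rw [hfst _ htg] at hpb
      simp only [Metric.mem_ball, hp₀, Prod.dist_eq, max_lt_iff] at hpb ⊢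
      refine ⟨?_, hpb.2.1, ?_⟩
      · rw [Real.dist_eq, sub_zero]
        exact (abs_lt.2 hsε).trans_le (min_le_right _ _)
      · refine lt_of_le_of_lt ((ContinuousMap.dist_le dist_nonneg).2 fun τ => ?_) hpb.2.2
        exact ContinuousMap.dist_apply_le_dist (f := α) (g := α₀) (s * τ)
    have hGβ : G ((s : ℝ) * ε, y, β) = ((s : ℝ) * ε, y, 0) := by
      simp only [hGdef, flowEquation]
      refine Prod.ext rfl (Prod.ext rfl ?_)
      ext τ
      simp only [ContinuousMap.sub_apply, ContinuousMap.smul_apply, volterra_apply,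
        ContinuousMap.zero_apply]
      rw [sub_sub, sub_eq_zero]
      have h1 := hsol ε hε y hy (s * τ)
      refine h1.trans ?_
      congr 1
      rw [mul_comm (s : ℝ) ε, mul_smul]
      congr 1
      have h2 := intervalIntegral.smul_integral_comp_mul_left (a := 0) (b := (τ : ℝ))
        (fun x => f (IccExtend zero_le_one α x)) (s : ℝ)
      rw [mul_zero] at h2
      rw [← hα, show ((s * τ : unitInterval) : ℝ) = s * τ from rfl, ← h2]
      congr 1
      apply intervalIntegral.integral_congr
      intro x hx
      rw [uIcc_of_le τ.2.1] at hx
      have hx1 : x ∈ Icc (0 : ℝ) 1 := ⟨hx.1, hx.2.trans τ.2.2⟩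
      have hx2 : (s : ℝ) * x ∈ Icc (0 : ℝ) 1 := hmul ⟨x, hx1⟩
      simp only [IccExtend_of_mem _ _ hx2, IccExtend_of_mem _ _ hx1]
      rfl
    have hinj : ((s : ℝ) * ε, y, β) = Θ.symm ((s : ℝ) * ε, y, 0) := by
      rw [← hGβ]
      exact (Θ.left_inv hβmem).symm
    have h4 := congrArg (fun r : ℝ × E × C(unitInterval, E) => r.2.2 1) hinj
    simp only [hβ, ContinuousMap.comp_apply, ContinuousMap.coe_mk, mul_one] at h4
    exact h4

/-- A smooth vector field on a Banach space has a smooth local flow. -/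
theorem exists_contDiffAt_localFlow [CompleteSpace E] {f : E → E} (hf : ContDiff ℝ ∞ f) (y₀ : E) :
    ∃ δ > 0, ∃ Φ : ℝ × E → E, ∀ s ∈ Ioo (-δ) δ, ∀ y ∈ Metric.ball y₀ δ,
      ContDiffAt ℝ ∞ Φ (s, y) ∧ HasDerivAt (fun σ => Φ (σ, y)) (f (Φ (s, y))) s ∧
      Φ (0, y) = y := by
  obtain ⟨δ, hδ, A, hA⟩ := exists_contDiffAt_flowEquation hf y₀
  refine ⟨δ, hδ, fun p => A p 1, fun s hs y hy => ?_⟩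
  have hsm : ∀ s ∈ Ioo (-δ) δ, ContDiffAt ℝ ∞ (fun p => A p 1) (s, y) := fun s hs =>
    ContDiffAt.comp (g := ContinuousMap.evalCLM ℝ (1 : unitInterval)) (s, y)
      (ContinuousLinearMap.contDiff _).contDiffAt (hA s hs y hy).1
  -- The rescaling identity and the substitution `τ = x s` turn the equation on `[0,1]` with scale
  -- `s` into the integral equation on `[0,s]`.
  have hint : ∀ s ∈ Ioo (-δ) δ, A (s, y) 1 = y + ∫ τ in (0 : ℝ)..s, f (A (τ, y) 1) := by
    intro s hs
    obtain ⟨-, h2, h3⟩ := hA s hs y hy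
    rw [h2 1]
    congr 1
    have h4 := intervalIntegral.smul_integral_comp_mul_right (a := 0) (b := 1)
        (fun x => f (A (x, y) 1)) s
    rw [zero_mul, one_mul] at h4
    rw [← h4]
    congr 1
    apply intervalIntegral.integral_congr
    intro x hx
    rw [show ((1 : unitInterval) : ℝ) = 1 from rfl, uIcc_of_le zero_le_one] at hx
    simp only [IccExtend_of_mem _ _ hx]
    rw [h3 ⟨x, hx⟩]
  have hc : ContinuousOn (fun τ => f (A (τ, y) 1)) (Ioo (-δ) δ) := by
    intro τ hτ
    have h1 : ContinuousAt (fun σ : ℝ => A (σ, y) 1) τ :=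
      ContinuousAt.comp (g := fun p => A p 1) (f := fun σ : ℝ => (σ, y)) (hsm τ hτ).continuousAt
        (by fun_prop)
    exact (hf.continuous.continuousAt.comp h1).continuousWithinAt
  have h0 : (0 : ℝ) ∈ Ioo (-δ) δ := ⟨neg_lt_zero.2 hδ, hδ⟩
  refine ⟨hsm s hs, ?_, ?_⟩
  · have h1 := intervalIntegral.integral_hasDerivAt_right (a := 0) (b := s)
      (f := fun τ => f (A (τ, y) 1))
      ((hc.mono (ordConnected_Ioo.uIcc_subset h0 hs)).intervalIntegrable)
      (hc.stronglyMeasurableAtFilter isOpen_Ioo s hs) (hc.continuousAt (Ioo_mem_nhds hs.1 hs.2))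
    refine (h1.const_add y).congr_of_eventuallyEq ?_
    filter_upwards [Ioo_mem_nhds hs.1 hs.2] with σ hσ using hint σ hσ
  · have := hint 0 h0
    rwa [intervalIntegral.integral_same, add_zero] at this

end Flow

/-! ### Local flows on manifolds, and the flow along a path. -/

section ManifoldFlow

variable {E : Type*} [NormedAddCommGroup E] [NormedSpace ℝ E]
  {H : Type*} [TopologicalSpace H] {I : ModelWithCorners ℝ E H}
  {N : Type*} [TopologicalSpace N] [ChartedSpace H N]

/-- The coordinate expression of a vector field in the chart at `x`. -/
noncomputable def chartField (X : ∀ p : N, TangentSpace I p) (x : N) (y : E) : E :=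
  mfderiv I 𝓘(ℝ, E) (extChartAt I x) ((extChartAt I x).symm y) (X ((extChartAt I x).symm y))

theorem chartField_extChartAt (X : ∀ p : N, TangentSpace I p) {x p : N}
    (hp : p ∈ (extChartAt I x).source) :
    chartField X x (extChartAt I x p) = mfderiv I 𝓘(ℝ, E) (extChartAt I x) p (X p) := by
  rw [chartField, (extChartAt I x).left_inv hp]

variable [IsManifold I ∞ N]

/-- Over the chart domain the derivative of the chart is the fiber map of the tangent bundle
trivialization at `x`, so this is the fiber component of a smooth section. -/
theorem contDiffOn_chartField {X : ∀ p : N, TangentSpace I p}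
    (hX : ContMDiff I I.tangent ∞ (fun p => (⟨p, X p⟩ : TangentBundle I N))) (x : N) :
    ContDiffOn ℝ ∞ (chartField X x) (extChartAt I x).target := by
  rw [← contMDiffOn_iff_contDiffOn]
  have h1 : ContMDiffOn 𝓘(ℝ, E) I.tangent ∞
      (fun y => (⟨(extChartAt I x).symm y, X ((extChartAt I x).symm y)⟩ : TangentBundle I N))
      (extChartAt I x).target := hX.comp_contMDiffOn (contMDiffOn_extChartAt_symm x)
  have hs : ∀ y ∈ (extChartAt I x).target, (extChartAt I x).symm y ∈ (chartAt H x).source := by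
    intro y hy
    have := (extChartAt I x).map_target hy
    rwa [extChartAt_source] at this
  intro y hy
  have h2 := ((trivializationAt E (TangentSpace I) x).contMDiffWithinAt_iff
    (f := fun y => (⟨(extChartAt I x).symm y, X ((extChartAt I x).symm y)⟩ : TangentBundle I N))
    (x₀ := y) (by
      rw [Trivialization.mem_source]
      exact hs y hy)).1 (h1 y hy)
  refine h2.2.congr_of_mem (fun z hz => ?_) hy
  refine (DFunLike.congr_fun (TangentBundle.continuousLinearMapAt_trivializationAt (I := I)
    (hs z hz)) (X ((extChartAt I x).symm z))).symm.trans ?_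
  exact (Trivialization.linearMapAt_apply (R := ℝ) (trivializationAt E (TangentSpace I) x) _).trans
    (if_pos (show _ ∈ _ from hs z hz))

variable [I.Boundaryless]

/-- A curve whose coordinates solve the equation of a vector field is tangent to it. -/
theorem hasMFDerivAt_extChartAt_symm_comp {X : ∀ p : N, TangentSpace I p} {x : N} {c : ℝ → E}
    {s : ℝ} (hc : HasDerivAt c (chartField X x (c s)) s) (hs : c s ∈ (extChartAt I x).target) :
    HasMFDerivAt 𝓘(ℝ, ℝ) I (fun σ => (extChartAt I x).symm (c σ)) s
      ((1 : ℝ →L[ℝ] ℝ).smulRight (X ((extChartAt I x).symm (c s)))) := by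
  have h1 : MDifferentiableAt 𝓘(ℝ, E) I (extChartAt I x).symm (c s) :=
    ((contMDiffOn_extChartAt_symm (I := I) (n := ∞) x).contMDiffAt
      ((isOpen_extChartAt_target x).mem_nhds hs)).mdifferentiableAt (by simp)
  have h2 := h1.hasMFDerivAt.comp s hc.hasFDerivAt.hasMFDerivAt
  refine h2.congr_mfderiv ?_
  have h3 := mfderivWithin_extChartAt_symm_comp_mfderiv_extChartAt (I := I) hs
  rw [I.range_eq_univ, mfderivWithin_univ] at h3
  refine ContinuousLinearMap.ext_ring ?_
  have h4 := DFunLike.congr_fun h3 (X ((extChartAt I x).symm (c s)))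
  refine Eq.trans ?_ (h4.trans (one_smul ℝ (X ((extChartAt I x).symm (c s)))).symm)
  exact congrArg (mfderiv 𝓘(ℝ, E) I (extChartAt I x).symm (c s)) (one_smul ℝ _)

/-- A smooth vector field on a manifold without boundary has a smooth local flow. The initial
points are given by their coordinates in the chart at `x₀`. -/
theorem exists_contMDiffAt_localFlow [FiniteDimensional ℝ E] {X : ∀ p : N, TangentSpace I p}
    (hX : ContMDiff I I.tangent ∞ (fun p => (⟨p, X p⟩ : TangentBundle I N))) (x₀ : N) :
    ∃ δ > 0, ∃ U ∈ 𝓝 x₀, U ⊆ (extChartAt I x₀).source ∧ ∃ Φ : ℝ × E → N,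
      ∀ s ∈ Ioo (-δ) δ, ∀ p ∈ U, ContMDiffAt 𝓘(ℝ, ℝ × E) I ∞ Φ (s, extChartAt I x₀ p) ∧
        HasMFDerivAt 𝓘(ℝ, ℝ) I (fun σ => Φ (σ, extChartAt I x₀ p)) s
          ((1 : ℝ →L[ℝ] ℝ).smulRight (X (Φ (s, extChartAt I x₀ p)))) ∧
        Φ (0, extChartAt I x₀ p) = p := by
  have : CompleteSpace E := FiniteDimensional.complete ℝ E
  set e := extChartAt I x₀ with he
  have htn : e.target ∈ 𝓝 (e x₀) := extChartAt_target_mem_nhds x₀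
  obtain ⟨r, hr, hrt⟩ := Metric.nhds_basis_closedBall.mem_iff.1 htn
  -- The cutoff makes the field smooth on all of `E`. Where `χ = 1`, on the ball of radius `r / 2`,
  -- the two fields agree, so the times and initial points are restricted to keep the flow there.
  let χ : ContDiffBump (e x₀) := ⟨r / 2, r, half_pos hr, half_lt_self hr⟩
  set f : E → E := fun y => χ y • chartField X x₀ y with hf
  have hfs : ContDiff ℝ ∞ f := by
    rw [contDiff_iff_contDiffAt]
    intro y
    by_cases hy : y ∈ e.target
    · exact χ.contDiffAt.smul ((contDiffOn_chartField hX x₀).contDiffAt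
        ((isOpen_extChartAt_target x₀).mem_nhds hy))
    · have hy' : y ∉ tsupport χ := by
        rw [χ.tsupport_eq]
        exact fun h => hy (hrt h)
      refine contDiffAt_const (c := 0) |>.congr_of_eventuallyEq ?_
      filter_upwards [(isClosed_tsupport χ).isOpen_compl.mem_nhds hy'] with z hz
      simp [hf, image_eq_zero_of_notMem_tsupport hz]
  obtain ⟨δ₀, hδ₀, Ψ, hΨ⟩ := exists_contDiffAt_localFlow hfs (e x₀)
  have h00 := hΨ 0 ⟨neg_lt_zero.2 hδ₀, hδ₀⟩ (e x₀) (Metric.mem_ball_self hδ₀)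
  have hnear : ∀ᶠ p in 𝓝 ((0 : ℝ), e x₀), Ψ p ∈ Metric.ball (e x₀) (r / 2) := by
    apply h00.1.continuousAt
    rw [h00.2.2]
    exact Metric.ball_mem_nhds _ (half_pos hr)
  obtain ⟨δ₁, hδ₁, hnear⟩ := Metric.eventually_nhds_iff.1 hnear
  have hδ : 0 < min δ₀ δ₁ := lt_min hδ₀ hδ₁
  refine ⟨min δ₀ δ₁, hδ, e.source ∩ e ⁻¹' Metric.ball (e x₀) (min δ₀ δ₁),
    inter_mem (extChartAt_source_mem_nhds x₀)
      ((continuousAt_extChartAt x₀).preimage_mem_nhds (Metric.ball_mem_nhds _ hδ)),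
    inter_subset_left, fun p => e.symm (Ψ p), ?_⟩
  rintro s hs p ⟨hps, hpb⟩
  have hs0 : s ∈ Ioo (-δ₀) δ₀ := by
    rw [mem_Ioo, ← abs_lt] at hs ⊢; exact hs.trans_le (min_le_left _ _)
  obtain ⟨h1, h2, h3⟩ := hΨ s hs0 (e p) (Metric.ball_subset_ball (min_le_left _ _) hpb)
  have h4 : Ψ (s, e p) ∈ Metric.ball (e x₀) (r / 2) := by
    apply hnear
    rw [Prod.dist_eq, max_lt_iff, Real.dist_eq, sub_zero]
    exact ⟨(abs_lt.2 hs).trans_le (min_le_right _ _), lt_of_lt_of_le hpb (min_le_right _ _)⟩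
  have h5 : Ψ (s, e p) ∈ e.target := hrt (Metric.ball_subset_closedBall
    (Metric.ball_subset_ball (half_le_self hr.le) h4))
  refine ⟨?_, ?_, ?_⟩
  · exact ((contMDiffOn_extChartAt_symm (I := I) (n := ∞) x₀).contMDiffAt
      ((isOpen_extChartAt_target x₀).mem_nhds h5)).comp (s, e p) h1.contMDiffAt
  · refine hasMFDerivAt_extChartAt_symm_comp (c := fun σ => Ψ (σ, e p)) ?_ h5
    have h6 : χ (Ψ (s, e p)) = 1 :=
      χ.one_of_mem_closedBall (Metric.ball_subset_closedBall h4)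
    simpa only [hf, h6, one_smul] using h2
  · simp only [h3]
    exact e.left_inv hps

/-- Along a path of initial points, the flow of a smooth vector field exists for a uniform time,
and it is given locally by smooth maps. -/
theorem exists_flow_along_path [FiniteDimensional ℝ E] [T2Space N]
    {X : ∀ p : N, TangentSpace I p}
    (hX : ContMDiff I I.tangent ∞ (fun p => (⟨p, X p⟩ : TangentBundle I N)))
    {V : unitInterval → N} (hV : ContMDiff (𝓡∂ 1) I ∞ V) :
    ∃ ε > 0, ∃ W : ℝ → unitInterval → N, W 0 = V ∧ ∀ t₀, ∃ (v : unitInterval → E) (Φ : ℝ × E → N),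
      ∀ᶠ t in 𝓝 t₀, ContMDiffAt (𝓡∂ 1) 𝓘(ℝ, E) ∞ v t ∧ ∀ s ∈ Ioo (-ε) ε,
        ContMDiffAt 𝓘(ℝ, ℝ × E) I ∞ Φ (s, v t) ∧
        HasMFDerivAt 𝓘(ℝ, ℝ) I (fun σ => Φ (σ, v t)) s
          ((1 : ℝ →L[ℝ] ℝ).smulRight (X (Φ (s, v t)))) ∧
        W s t = Φ (s, v t) := by
  choose δ hδ U hU hUs Φ hΦ using fun x₀ : N => exists_contMDiffAt_localFlow hX x₀
  -- Interiors are used so that a center `x` chosen for one parameter also serves the nearby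
  -- parameters.
  have hunif : ∃ ε > 0, ∀ t ∈ (univ : Set unitInterval), ∃ x : N,
      V t ∈ interior (U x) ∧ ε ≤ δ x := by
    refine isCompact_univ.induction_on (p := fun K => ∃ ε > 0, ∀ t ∈ K, ∃ x : N,
      V t ∈ interior (U x) ∧ ε ≤ δ x) ⟨1, one_pos, by simp⟩ ?_ ?_ ?_
    · rintro K K' hK ⟨ε, hε, h⟩
      exact ⟨ε, hε, fun t ht => h t (hK ht)⟩
    · rintro K K' ⟨ε, hε, h⟩ ⟨ε', hε', h'⟩
      refine ⟨min ε ε', lt_min hε hε', ?_⟩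
      rintro t (ht | ht)
      · obtain ⟨x, hx, hx'⟩ := h t ht
        exact ⟨x, hx, (min_le_left _ _).trans hx'⟩
      · obtain ⟨x, hx, hx'⟩ := h' t ht
        exact ⟨x, hx, (min_le_right _ _).trans hx'⟩
    · intro t _
      refine ⟨V ⁻¹' interior (U (V t)), mem_nhdsWithin_of_mem_nhds
        (hV.continuous.continuousAt.preimage_mem_nhds (interior_mem_nhds.2 (hU _))),
        δ (V t), hδ _, fun t' ht' => ⟨V t, ht', le_rfl⟩⟩
  obtain ⟨ε, hε, h⟩ := hunif
  choose x hxU hxδ using fun t => h t (mem_univ t)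
  have hmem : ∀ t, V t ∈ U (x t) := fun t => interior_subset (hxU t)
  have hsub : ∀ t, ∀ s ∈ Ioo (-ε) ε, s ∈ Ioo (-δ (x t)) (δ (x t)) := fun t s hs =>
    ⟨(neg_le_neg (hxδ t)).trans_lt hs.1, hs.2.trans_le (hxδ t)⟩
  have h0 : (0 : ℝ) ∈ Ioo (-ε) ε := ⟨neg_lt_zero.2 hε, hε⟩
  refine ⟨ε, hε, fun s t => Φ (x t) (s, extChartAt I (x t) (V t)), ?_, fun t₀ =>
    ⟨fun t => extChartAt I (x t₀) (V t), Φ (x t₀), ?_⟩⟩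
  · funext t
    exact (hΦ _ 0 (hsub t 0 h0) _ (hmem t)).2.2
  · filter_upwards [hV.continuous.continuousAt.preimage_mem_nhds
      (isOpen_interior.mem_nhds (hxU t₀))] with t ht
    have ht' : V t ∈ U (x t₀) := interior_subset ht
    refine ⟨?_, fun s hs => ?_⟩
    · have h1 := hUs _ ht'
      rw [extChartAt_source] at h1
      exact (contMDiffAt_extChartAt' (I := I) (n := ∞) h1).comp t (hV t)
    · obtain ⟨h1, h2, h3⟩ := hΦ _ s (hsub t₀ s hs) _ ht'
      refine ⟨h1, h2, ?_⟩
      -- The center `x t` may jump with `t`; uniqueness of integral curves allows the fixed center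
      -- `x t₀` for all `t` near `t₀`, hence a single smooth `Φ`.
      have hc := isMIntegralCurveOn_Ioo_eqOn_of_contMDiff_boundaryless (I := I) (v := X)
        (γ := fun σ => Φ (x t) (σ, extChartAt I (x t) (V t)))
        (γ' := fun σ => Φ (x t₀) (σ, extChartAt I (x t₀) (V t))) h0 (hX.of_le (by simp))
        (fun σ hσ => (hΦ _ σ (hsub t σ hσ) _ (hmem t)).2.1.hasMFDerivWithinAt)
        (fun σ hσ => (hΦ _ σ (hsub t₀ σ hσ) _ ht').2.1.hasMFDerivWithinAt)
        (by
          rw [(hΦ _ 0 (hsub t 0 h0) _ (hmem t)).2.2, (hΦ _ 0 (hsub t₀ 0 h0) _ ht').2.2])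
      exact hc hs

end ManifoldFlow

/-! ### From smooth local formulas to velocities in the `C¹` norm. -/

section PathVelocity

/-- The remainder of the first order expansion in time of a `C²` map is `o(s - s₀)` in the `C¹`
sense with respect to the space variable, locally uniformly. -/
theorem ContDiffAt.eventually_time_remainder_le {P F : Type*} [NormedAddCommGroup P]
    [NormedSpace ℝ P] [NormedAddCommGroup F] [NormedSpace ℝ F] {Ψ : ℝ × P → F} {s₀ : ℝ} {p₀ : P}
    (hΨ : ContDiffAt ℝ 2 Ψ (s₀, p₀)) {c : ℝ} (hc : 0 < c) :
    ∀ᶠ z : ℝ × P in 𝓝 (s₀, p₀),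
      ‖Ψ z - Ψ (s₀, z.2) - (z.1 - s₀) • fderiv ℝ Ψ (s₀, z.2) (1, 0)‖ ≤ c * |z.1 - s₀| ∧
      ∃ L : P →L[ℝ] F, ‖L‖ ≤ c * |z.1 - s₀| ∧ HasFDerivAt (fun p =>
        Ψ (z.1, p) - Ψ (s₀, p) - (z.1 - s₀) • fderiv ℝ Ψ (s₀, p) (1, 0)) L z.2 := by
  have hT : Tendsto (fun z : ℝ × P => (((z.1 - s₀, 0), (s₀, z.2)) : (ℝ × P) × (ℝ × P)))
      (𝓝 (s₀, p₀)) (𝓝 (0, (s₀, p₀))) := by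
    have : Continuous (fun z : ℝ × P => (((z.1 - s₀, 0), (s₀, z.2)) : (ℝ × P) × (ℝ × P))) := by
      fun_prop
    have h := this.tendsto (s₀, p₀)
    rw [sub_self] at h
    exact h
  have hT2 : Tendsto (fun z : ℝ × P => ((s₀, z.2) : ℝ × P)) (𝓝 (s₀, p₀)) (𝓝 (s₀, p₀)) := by
    have : Continuous (fun z : ℝ × P => ((s₀, z.2) : ℝ × P)) := by fun_prop
    exact this.tendsto (s₀, p₀)
  -- The Taylor estimate with the increment `(z.1 - s₀, 0)` is used twice: for `Ψ`, and for `fderiv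
  -- ℝ Ψ` to control the derivative of the remainder in `p`.
  have h1 := hT.eventually ((hΨ.of_le one_le_two).eventually_norm_sub_sub_fderiv_le hc)
  have h2 := hT.eventually
    ((hΨ.fderiv_right (m := 1) (by norm_num)).eventually_norm_sub_sub_fderiv_le hc)
  have h3 := hΨ.eventually (by simp)
  filter_upwards [h1, h2, h3, hT2.eventually h3] with z h1 h2 h3 h4
  have hn : ‖((z.1 - s₀, 0) : ℝ × P)‖ = |z.1 - s₀| := by simp [Prod.norm_def]
  have hz : ((s₀, z.2) : ℝ × P) + (z.1 - s₀, 0) = z := by ext <;> simp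
  have hv : ((z.1 - s₀, 0) : ℝ × P) = (z.1 - s₀) • (1, 0) := by simp
  rw [hn] at h1 h2
  simp only [hz] at h1 h2
  refine ⟨?_, ?_⟩
  · rwa [hv, map_smul] at h1
  · set D := fderiv ℝ Ψ z - fderiv ℝ Ψ (s₀, z.2)
      - fderiv ℝ (fderiv ℝ Ψ) (s₀, z.2) (z.1 - s₀, 0) with hD
    refine ⟨D.comp (ContinuousLinearMap.inr ℝ ℝ P), ?_, ?_⟩
    · refine (ContinuousLinearMap.opNorm_comp_le _ _).trans ?_
      exact (mul_le_of_le_one_right (norm_nonneg _)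
        (ContinuousLinearMap.norm_inr_le_one ℝ ℝ P)).trans h2
    · have e1 : HasFDerivAt (fun p => Ψ (z.1, p))
          ((fderiv ℝ Ψ z).comp (ContinuousLinearMap.inr ℝ ℝ P)) z.2 :=
        HasFDerivAt.comp (g := Ψ) z.2 (h3.differentiableAt (by simp)).hasFDerivAt
          (hasFDerivAt_prodMk_right z.1 z.2)
      have e2 : HasFDerivAt (fun p => Ψ (s₀, p))
          ((fderiv ℝ Ψ (s₀, z.2)).comp (ContinuousLinearMap.inr ℝ ℝ P)) z.2 :=
        HasFDerivAt.comp (g := Ψ) z.2 (h4.differentiableAt (by simp)).hasFDerivAt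
          (hasFDerivAt_prodMk_right s₀ z.2)
      have e3 : HasFDerivAt (fun p => fderiv ℝ Ψ (s₀, p))
          ((fderiv ℝ (fderiv ℝ Ψ) (s₀, z.2)).comp (ContinuousLinearMap.inr ℝ ℝ P)) z.2 :=
        HasFDerivAt.comp (g := fderiv ℝ Ψ) z.2
          ((h4.fderiv_right (m := 1) (by norm_num)).differentiableAt (by simp)).hasFDerivAt
          (hasFDerivAt_prodMk_right s₀ z.2)
      have e4 := e3.clm_apply (hasFDerivAt_const ((1, 0) : ℝ × P) z.2)
      refine ((e1.sub e2).sub (e4.const_smul (z.1 - s₀))).congr_fderiv ?_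
      refine ContinuousLinearMap.ext fun w => ?_
      -- Differentiating the time derivative in `p` puts `w` in the first slot of the second
      -- derivative, while `D` has it in the second.
      have hsymm := h4.isSymmSndFDerivAt (by simp) (0, w) (1, 0)
      rw [hD, hv, map_smul]
      simp [hsymm]

/-- A smooth function on `[0,1]` has a locally bounded derivative. -/
theorem ContMDiffAt.exists_hasDerivWithinAt_IccExtend {P : Type*} [NormedAddCommGroup P]
    [NormedSpace ℝ P] {v : unitInterval → P} {t₀ : unitInterval}
    (hv : ContMDiffAt (𝓡∂ 1) 𝓘(ℝ, P) ∞ v t₀) :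
    ∃ B : ℝ, 0 ≤ B ∧ ∀ᶠ t : unitInterval in 𝓝 t₀, ∃ v' : P, ‖v'‖ ≤ B ∧
      HasDerivWithinAt (IccExtend zero_le_one v) v' (Icc (0 : ℝ) 1) (t : ℝ) := by
  have h1 : ContDiffWithinAt ℝ 1 (IccExtend zero_le_one v) (Icc (0 : ℝ) 1) (t₀ : ℝ) :=
    (contMDiffWithinAt_iff_contDiffWithinAt.1
      (contMDiffWithinAt_comp_projIcc_iff.2 hv)).of_le (by simp)
  have h2 := (h1.fderivWithin_right (m := 0) (uniqueDiffOn_Icc zero_lt_one) (by norm_num)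
    t₀.2).continuousWithinAt
  have h3 := h1.eventually (by simp)
  rw [insert_eq_of_mem t₀.2] at h3
  have hT : Tendsto (Subtype.val : unitInterval → ℝ) (𝓝 t₀) (𝓝[Icc 0 1] (t₀ : ℝ)) :=
    tendsto_nhdsWithin_iff.2 ⟨continuous_subtype_val.tendsto t₀, Eventually.of_forall fun t => t.2⟩
  refine ⟨‖fderivWithin ℝ (IccExtend zero_le_one v) (Icc (0 : ℝ) 1) (t₀ : ℝ)‖ + 1, by positivity,
    ?_⟩
  filter_upwards [hT.eventually h3,
    hT.eventually (h2.norm.eventually_lt_const (lt_add_one _))] with t ht1 ht2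
  have h4 := (ht1.differentiableWithinAt (by simp)).hasDerivWithinAt
  refine ⟨_, ?_, h4⟩
  rw [← fderivWithin_derivWithin]
  refine (ContinuousLinearMap.le_opNorm _ _).trans ?_
  simpa using ht2.le

variable {E : Type*} [NormedAddCommGroup E] [NormedSpace ℝ E]

theorem hasDerivWithinAt_IccExtend_of_eventuallyEq {P : Type*} [NormedAddCommGroup P]
    [NormedSpace ℝ P] {u : unitInterval → E} {v : unitInterval → P} {R : P → E} {L : P →L[ℝ] E}
    {v' : P} {t : unitInterval} (hu : ∀ᶠ t' in 𝓝 t, u t' = R (v t')) (hR : HasFDerivAt R L (v t))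
    (hv : HasDerivWithinAt (IccExtend zero_le_one v) v' (Icc (0 : ℝ) 1) (t : ℝ)) :
    HasDerivWithinAt (IccExtend zero_le_one u) (L v') (Icc (0 : ℝ) 1) (t : ℝ) := by
  have ht : projIcc (0 : ℝ) 1 zero_le_one (t : ℝ) = t := projIcc_val _ t
  have h1 : HasFDerivAt R L (IccExtend zero_le_one v (t : ℝ)) := by
    rwa [IccExtend_val]
  refine (h1.comp_hasDerivWithinAt (t : ℝ) hv).congr_of_eventuallyEq ?_ ?_
  · have h2 : Tendsto (projIcc (0 : ℝ) 1 zero_le_one) (𝓝 (t : ℝ)) (𝓝 t) := by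
      have := (continuous_projIcc (h := zero_le_one (α := ℝ))).tendsto (t : ℝ)
      rwa [ht] at this
    exact mem_nhdsWithin_of_mem_nhds (h2.eventually hu)
  · simp only [Function.comp, IccExtend_val]
    exact hu.self_of_nhds

theorem c1NormOn_le {K : Set unitInterval} {u : unitInterval → E} {c : ℝ}
    (h : ∀ t ∈ K, ‖u t‖ ≤ c ∧
      ‖derivWithin (IccExtend zero_le_one u) (Icc (0 : ℝ) 1) (t : ℝ)‖ ≤ c) :
    c1NormOn K u ≤ ENNReal.ofReal c := by
  refine iSup₂_le fun t ht => max_le ?_ ?_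
  · rw [← ofReal_norm]
    exact ENNReal.ofReal_le_ofReal (h t ht).1
  · rw [← ofReal_norm]
    exact ENNReal.ofReal_le_ofReal (h t ht).2

variable {H : Type*} [TopologicalSpace H] {I : ModelWithCorners ℝ E H}
  {N : Type*} [TopologicalSpace N] [ChartedSpace H N] [IsManifold I ∞ N]

/-- The coordinate expression of the velocity of a curve. -/
theorem HasMFDerivAt.hasDerivAt_extChartAt {c : ℝ → N} {s : ℝ} {x : N} {w : TangentSpace I (c s)}
    (hc : HasMFDerivAt 𝓘(ℝ, ℝ) I c s ((1 : ℝ →L[ℝ] ℝ).smulRight w))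
    (hs : c s ∈ (extChartAt I x).source) :
    HasDerivAt (fun σ => extChartAt I x (c σ)) (mfderiv I 𝓘(ℝ, E) (extChartAt I x) (c s) w) s := by
  rw [extChartAt_source] at hs
  have h1 := (mdifferentiableAt_extChartAt (I := I) hs).hasMFDerivAt.comp s hc
  have h2 : HasFDerivAt (fun σ => extChartAt I x (c σ)) (_ : ℝ →L[ℝ] E) s := h1.hasFDerivAt
  refine h2.hasDerivAt.congr_deriv ?_
  exact congrArg (mfderiv I 𝓘(ℝ, E) (extChartAt I x) (c s)) (one_smul ℝ w)

/-- A curve of paths which is given locally by smooth maps, depending on the path parameter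
through a smooth function, has the pointwise velocity as its velocity. -/
theorem hasPathVelocity_of_locally_smooth {P : Type*} [NormedAddCommGroup P] [NormedSpace ℝ P]
    {Γ : ℝ → PathSpace I N} {S : Set ℝ} {s₀ : ℝ} (hs₀ : s₀ ∈ S) {V : PathTangent (Γ s₀)}
    (h : ∀ t₀, ∃ (v : unitInterval → P) (Φ : ℝ × P → N),
      ContMDiffAt (𝓡∂ 1) 𝓘(ℝ, P) ∞ v t₀ ∧ ContMDiffAt 𝓘(ℝ, ℝ × P) I ∞ Φ (s₀, v t₀) ∧
      ∀ᶠ t in 𝓝 t₀, (∀ s ∈ S, (Γ s).toFun t = Φ (s, v t)) ∧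
        HasMFDerivAt 𝓘(ℝ, ℝ) I (fun σ => Φ (σ, v t)) s₀
          ((1 : ℝ →L[ℝ] ℝ).smulRight (V.toFun t))) :
    HasPathVelocity Γ S s₀ V := by
  intro x K hK hKs
  -- The estimates are proved jointly in `(s, t)` near `(s₀, t₀)`, so that compactness of `K` makes
  -- them uniform in `t`.
  have key : ∀ t₀ ∈ K, ∀ ε : ℝ, 0 < ε → ∀ᶠ z : ℝ × unitInterval in 𝓝 (s₀, t₀), z.1 ∈ S →
      (Γ z.1).toFun z.2 ∈ (extChartAt I x).source ∧
      ‖extChartAt I x ((Γ z.1).toFun z.2) - extChartAt I x ((Γ s₀).toFun z.2)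
          - (z.1 - s₀) • V.inChart x z.2‖ ≤ ε * |z.1 - s₀| ∧
      ‖derivWithin (IccExtend zero_le_one (fun t => extChartAt I x ((Γ z.1).toFun t)
          - extChartAt I x ((Γ s₀).toFun t) - (z.1 - s₀) • V.inChart x t))
          (Icc (0 : ℝ) 1) (z.2 : ℝ)‖ ≤ ε * |z.1 - s₀| := by
    intro t₀ ht₀ ε hε
    obtain ⟨v, Φ, hv, hΦ, hev⟩ := h t₀
    have hsrc : Φ (s₀, v t₀) ∈ (extChartAt I x).source := by
      rw [← hev.self_of_nhds.1 s₀ hs₀]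
      exact hKs t₀ ht₀
    set Ψ : ℝ × P → E := fun z => extChartAt I x (Φ z) with hΨdef
    have hΨ : ContDiffAt ℝ 2 Ψ (s₀, v t₀) := by
      rw [extChartAt_source] at hsrc
      exact (contMDiffAt_iff_contDiffAt.1
        ((contMDiffAt_extChartAt' (I := I) (n := ∞) hsrc).comp (s₀, v t₀) hΦ)).of_le
          (show ((2 : ℕ∞) : ℕ∞ω) ≤ ((⊤ : ℕ∞) : ℕ∞ω) from mod_cast le_top)
    have hT : Tendsto (fun z : ℝ × unitInterval => (z.1, v z.2)) (𝓝 (s₀, t₀))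
        (𝓝 (s₀, v t₀)) := by
      have h1 : ContinuousAt (fun z : ℝ × unitInterval => (z.1, v z.2)) (s₀, t₀) :=
        continuousAt_fst.prodMk (ContinuousAt.comp (g := v) (f := Prod.snd) hv.continuousAt
          continuousAt_snd)
      exact h1
    have hT₀ : Tendsto (fun t => (s₀, v t)) (𝓝 t₀) (𝓝 (s₀, v t₀)) :=
      tendsto_const_nhds.prodMk_nhds hv.continuousAt
    have hT₂ : Tendsto (fun z : ℝ × unitInterval => z.2) (𝓝 (s₀, t₀)) (𝓝 t₀) :=
      continuous_snd.tendsto (s₀, t₀)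
    have hsrcev : ∀ᶠ z in 𝓝 (s₀, v t₀), Φ z ∈ (extChartAt I x).source :=
      hΦ.continuousAt ((isOpen_extChartAt_source x).mem_nhds hsrc)
    have hchart : ∀ᶠ t in 𝓝 t₀, V.inChart x t = fderiv ℝ Ψ (s₀, v t) (1, 0) := by
      filter_upwards [hev, hT₀.eventually hsrcev, hT₀.eventually (hΨ.eventually (by simp))]
        with t h1 h2 h3
      have h4 := HasMFDerivAt.hasDerivAt_extChartAt h1.2 h2
      have h5 := HasFDerivAt.comp_hasDerivAt (l := Ψ) (f := fun σ : ℝ => (σ, v t)) s₀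
        (h3.differentiableAt (by simp)).hasFDerivAt
        ((hasDerivAt_id s₀).prodMk (hasDerivAt_const s₀ (v t)))
      rw [← h4.unique h5, PathTangent.inChart, h1.1 s₀ hs₀]
    have hrem : ∀ᶠ t in 𝓝 t₀, ∀ s ∈ S, extChartAt I x ((Γ s).toFun t)
        - extChartAt I x ((Γ s₀).toFun t) - (s - s₀) • V.inChart x t
        = Ψ (s, v t) - Ψ (s₀, v t) - (s - s₀) • fderiv ℝ Ψ (s₀, v t) (1, 0) := by
      filter_upwards [hev, hchart] with t h1 h2 s hs
      rw [h2, h1.1 s hs, h1.1 s₀ hs₀]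
    obtain ⟨B, hB, hvB⟩ := hv.exists_hasDerivWithinAt_IccExtend
    -- The chain rule costs a factor of at most `B`, the bound for the derivative of `v`; dividing
    -- by `B + 1` absorbs it and also keeps the constant at most `ε`.
    have hc : 0 < ε / (B + 1) := by positivity
    have hcε : ε / (B + 1) ≤ ε := div_le_self hε.le (by linarith)
    have hcB : ε / (B + 1) * B ≤ ε := by
      rw [div_mul_eq_mul_div, div_le_iff₀ (by positivity)]
      nlinarith
    filter_upwards [hT.eventually (hΨ.eventually_time_remainder_le hc), hT.eventually hsrcev,
      hT₂.eventually hrem.eventually_nhds, hT₂.eventually hvB, hT₂.eventually hev]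
      with z h1 h2 h3 h4 h5 hz
    obtain ⟨hR, L, hL, hRL⟩ := h1
    obtain ⟨v', hv'B, hv'⟩ := h4
    refine ⟨?_, ?_, ?_⟩
    · rw [h5.1 _ hz]; exact h2
    · rw [h3.self_of_nhds _ hz]
      exact hR.trans (mul_le_mul_of_nonneg_right hcε (abs_nonneg _))
    · have h6 := hasDerivWithinAt_IccExtend_of_eventuallyEq
        (u := fun t => extChartAt I x ((Γ z.1).toFun t)
          - extChartAt I x ((Γ s₀).toFun t) - (z.1 - s₀) • V.inChart x t)
        (h3.mono fun t ht => ht _ hz) hRL hv'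
      rw [h6.derivWithin (uniqueDiffOn_Icc zero_lt_one _ z.2.2)]
      calc ‖L v'‖ ≤ ‖L‖ * ‖v'‖ := L.le_opNorm v'
        _ ≤ (ε / (B + 1) * |z.1 - s₀|) * B :=
          mul_le_mul hL hv'B (norm_nonneg _) (by positivity)
        _ = (ε / (B + 1) * B) * |z.1 - s₀| := by ring
        _ ≤ ε * |z.1 - s₀| := mul_le_mul_of_nonneg_right hcB (abs_nonneg _)
  have hall := fun (ε : ℝ) (hε : 0 < ε) => hK.eventually_forall_of_forall_eventually (x₀ := s₀)
    (P := fun s t => s ∈ S →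
      (Γ s).toFun t ∈ (extChartAt I x).source ∧
      ‖extChartAt I x ((Γ s).toFun t) - extChartAt I x ((Γ s₀).toFun t)
          - (s - s₀) • V.inChart x t‖ ≤ ε * |s - s₀| ∧
      ‖derivWithin (IccExtend zero_le_one (fun t => extChartAt I x ((Γ s).toFun t)
          - extChartAt I x ((Γ s₀).toFun t) - (s - s₀) • V.inChart x t))
          (Icc (0 : ℝ) 1) (t : ℝ)‖ ≤ ε * |s - s₀|) (fun t ht => key t ht ε hε)
  refine ⟨?_, fun ε hε => ?_⟩
  · rw [eventually_nhdsWithin_iff]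
    filter_upwards [hall 1 one_pos] with s hs hsS t ht using (hs t ht hsS).1
  · rw [eventually_nhdsWithin_iff]
    filter_upwards [hall ε hε] with s hs hsS
    exact c1NormOn_le fun t ht => (hs t ht hsS).2

end PathVelocity

/-! ### Uniqueness of integral curves with one-sided derivatives. -/

section Uniqueness

/-- The total space of a fiber bundle with Hausdorff base and fiber is Hausdorff. -/
theorem FiberBundle.t2Space_totalSpace {B F : Type*} {Z : B → Type*} [TopologicalSpace B]
    [TopologicalSpace F] [TopologicalSpace (TotalSpace F Z)] [∀ b, TopologicalSpace (Z b)]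
    [FiberBundle F Z] [T2Space B] [T2Space F] : T2Space (TotalSpace F Z) := by
  refine ⟨fun p q hpq => ?_⟩
  by_cases hb : p.proj = q.proj
  · set e := trivializationAt F Z p.proj
    have hp : p ∈ e.source := e.mem_source.2 (mem_baseSet_trivializationAt F Z p.proj)
    have hq : q ∈ e.source := e.mem_source.2 (hb ▸ mem_baseSet_trivializationAt F Z p.proj)
    obtain ⟨u, v, hu, hv, hpu, hqv, huv⟩ := t2_separation
      (fun h => hpq (e.toPartialEquiv.injOn hp hq h) : e p ≠ e q)
    refine ⟨e.source ∩ e ⁻¹' u, e.source ∩ e ⁻¹' v,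
      e.continuousOn_toFun.isOpen_inter_preimage e.open_source hu,
      e.continuousOn_toFun.isOpen_inter_preimage e.open_source hv, ⟨hp, hpu⟩, ⟨hq, hqv⟩, ?_⟩
    exact (huv.preimage e).mono inter_subset_right inter_subset_right
  · obtain ⟨u, v, hu, hv, hpu, hqv, huv⟩ := t2_separation hb
    exact ⟨_, _, hu.preimage (FiberBundle.continuous_proj F Z),
      hv.preimage (FiberBundle.continuous_proj F Z), hpu, hqv, huv.preimage _⟩

variable {E : Type*} [NormedAddCommGroup E] [NormedSpace ℝ E]

theorem enorm_le_c1NormOn {K : Set unitInterval} {t : unitInterval} (ht : t ∈ K)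
    (u : unitInterval → E) : ‖u t‖ₑ ≤ c1NormOn K u :=
  (le_max_left _ _).trans (le_iSup₂ (f := fun (t : unitInterval) (_ : t ∈ K) =>
    max ‖u t‖ₑ ‖derivWithin (IccExtend zero_le_one u) (Icc (0 : ℝ) 1) (t : ℝ)‖ₑ) t ht)

variable
  {H : Type*} [TopologicalSpace H] {I : ModelWithCorners ℝ E H}
  {N : Type*} [TopologicalSpace N] [ChartedSpace H N]

/-- A curve in a manifold which satisfies over `S` the equation of the vector field `X`, with
derivatives within `S`, expressed in every chart. -/
def SolvesInChartsOn (X : ∀ p : N, TangentSpace I p) (w : ℝ → N) (S : Set ℝ) : Prop :=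
  ∀ s ∈ S, ∀ x : N, w s ∈ (extChartAt I x).source →
    (∀ᶠ σ in 𝓝[S] s, w σ ∈ (extChartAt I x).source) ∧
    HasDerivWithinAt (fun σ => extChartAt I x (w σ)) (chartField X x (extChartAt I x (w s))) S s

variable {X : ∀ p : N, TangentSpace I p} {w w₁ w₂ : ℝ → N} {S T : Set ℝ}

theorem SolvesInChartsOn.mono (h : SolvesInChartsOn X w S) (hT : T ⊆ S) :
    SolvesInChartsOn X w T := fun s hs x hx =>
  ⟨(h s (hT hs) x hx).1.filter_mono (nhdsWithin_mono s hT), (h s (hT hs) x hx).2.mono hT⟩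

/-- Differentiability in the chart gives continuity in `N` only because nearby values are required
to remain in the chart domain, where the chart can be inverted. -/
theorem SolvesInChartsOn.continuousOn (h : SolvesInChartsOn X w S) : ContinuousOn w S := by
  intro s hs
  have hsrc := mem_extChartAt_source (I := I) (w s)
  obtain ⟨h1, h2⟩ := h s hs (w s) hsrc
  have h3 : ContinuousWithinAt (fun σ => (extChartAt I (w s)).symm (extChartAt I (w s) (w σ))) S s :=
    (continuousAt_extChartAt_symm (I := I) (w s)).comp_continuousWithinAt
      (f := fun σ => extChartAt I (w s) (w σ)) h2.continuousWithinAt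
  refine h3.congr_of_eventuallyEq ?_ ((extChartAt I (w s)).left_inv hsrc).symm
  filter_upwards [h1] with σ hσ using ((extChartAt I (w s)).left_inv hσ).symm

/-- Solutions on a compact interval, with one-sided derivatives at the end points, are determined
by their initial value. -/
theorem SolvesInChartsOn.eqOn_Icc [IsManifold I ∞ N] [I.Boundaryless] [T2Space N] {b : ℝ}
    (hX : ContMDiff I I.tangent ∞ (fun p => (⟨p, X p⟩ : TangentBundle I N)))
    (h₁ : SolvesInChartsOn X w₁ (Icc 0 b)) (h₂ : SolvesInChartsOn X w₂ (Icc 0 b))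
    (h0 : w₁ 0 = w₂ 0) : EqOn w₁ w₂ (Icc 0 b) := by
  have hclosed : IsClosed ({s | w₁ s = w₂ s} ∩ Icc 0 b) := by
    have := (h₁.continuousOn.prodMk h₂.continuousOn).preimage_isClosed_of_isClosed isClosed_Icc
      isClosed_diagonal
    rwa [inter_comm] at this
  -- Continuous induction: the coincidence set is closed since `N` is Hausdorff, and from each of
  -- its points before `b` it extends to the right, because the field is Lipschitz in a chart. Only
  -- right derivatives are needed.
  refine hclosed.Icc_subset_of_forall_exists_gt h0 ?_
  rintro s ⟨hs, hsb⟩ y hy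
  change w₁ s = w₂ s at hs
  set e := extChartAt I (w₁ s) with he
  have hs₁ : w₁ s ∈ e.source := mem_extChartAt_source (I := I) (w₁ s)
  have hs₂ : w₂ s ∈ e.source := hs ▸ hs₁
  have hsI : s ∈ Icc 0 b := Ico_subset_Icc_self hsb
  obtain ⟨K, B, hB, hlip⟩ := (((contDiffOn_chartField hX (w₁ s)).contDiffAt
    (extChartAt_target_mem_nhds (w₁ s))).of_le (by simp : (1 : ℕ∞ω) ≤ _)).exists_lipschitzOnWith
  obtain ⟨hev₁, hd₁⟩ := h₁ s hsI (w₁ s) hs₁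
  obtain ⟨hev₂, hd₂⟩ := h₂ s hsI (w₁ s) hs₂
  have hB' : B ∈ 𝓝 (e (w₂ s)) := by rwa [← hs]
  have hB₁ := hd₁.continuousWithinAt.tendsto.eventually_mem hB
  have hB₂ := hd₂.continuousWithinAt.tendsto.eventually_mem hB'
  have hle : 𝓝[≥] s ≤ 𝓝[Icc 0 b] s := by
    rw [← nhdsWithin_Icc_eq_nhdsGE hsb.2]
    exact nhdsWithin_mono s (Icc_subset_Icc_left hsb.1)
  obtain ⟨c, hc, hsub⟩ := mem_nhdsGE_iff_exists_Icc_subset.1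
    (inter_mem (hle (hev₁.and (hev₂.and (hB₁.and hB₂))))
      (Icc_mem_nhdsGE (lt_min hsb.2 hy)))
  have hcm := hsub (right_mem_Icc.2 hc.le)
  have hIcc : Icc s c ⊆ Icc 0 b := fun σ hσ =>
    ⟨hsb.1.trans hσ.1, (hsub hσ).2.2.trans (min_le_left _ _)⟩
  have hcont : ∀ {w : ℝ → N}, SolvesInChartsOn X w (Icc 0 b) → (∀ σ ∈ Icc s c, w σ ∈ e.source) →
      ContinuousOn (fun σ => e (w σ)) (Icc s c) := fun hw hwe σ hσ =>
    (hw σ (hIcc hσ) (w₁ s) (hwe σ hσ)).2.continuousWithinAt.mono hIcc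
  have hder : ∀ {w : ℝ → N}, SolvesInChartsOn X w (Icc 0 b) → (∀ σ ∈ Icc s c, w σ ∈ e.source) →
      ∀ σ ∈ Ico s c, HasDerivWithinAt (fun σ => e (w σ)) (chartField X (w₁ s) (e (w σ)))
        (Ici σ) σ := by
    intro w hw hwe σ hσ
    refine (hw σ (hIcc (Ico_subset_Icc_self hσ)) (w₁ s)
      (hwe σ (Ico_subset_Icc_self hσ))).2.mono_of_mem_nhdsWithin ?_
    exact mem_of_superset (Icc_mem_nhdsGE hσ.2)
      ((Icc_subset_Icc_left hσ.1).trans hIcc)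
  have huniq := ODE_solution_unique_of_mem_Icc_right (v := fun _ => chartField X (w₁ s))
    (s := fun _ => B) (K := K) (a := s) (b := c) (f := fun σ => e (w₁ σ)) (g := fun σ => e (w₂ σ))
    (fun _ _ => hlip) (hcont h₁ fun σ hσ => (hsub hσ).1.1) (hder h₁ fun σ hσ => (hsub hσ).1.1)
    (fun σ hσ => (hsub (Ico_subset_Icc_self hσ)).1.2.2.1)
    (hcont h₂ fun σ hσ => (hsub hσ).1.2.1) (hder h₂ fun σ hσ => (hsub hσ).1.2.1)
    (fun σ hσ => (hsub (Ico_subset_Icc_self hσ)).1.2.2.2) (congrArg e hs)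
  exact ⟨c, e.injOn hcm.1.1 hcm.1.2.1 (huniq (right_mem_Icc.2 hc.le)), hc,
    hcm.2.2.trans (min_le_right _ _)⟩

variable [IsManifold I ∞ N]

/-- A velocity of a curve of paths is in particular a pointwise velocity. -/
theorem HasPathVelocity.hasDerivWithinAt {Γ : ℝ → PathSpace I N} {s₀ : ℝ}
    {V : PathTangent (Γ s₀)} (h : HasPathVelocity Γ S s₀ V) {x : N} {t : unitInterval}
    (ht : (Γ s₀).toFun t ∈ (extChartAt I x).source) :
    (∀ᶠ s in 𝓝[S] s₀, (Γ s).toFun t ∈ (extChartAt I x).source) ∧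
    HasDerivWithinAt (fun s => extChartAt I x ((Γ s).toFun t)) (V.inChart x t) S s₀ := by
  obtain ⟨h1, h2⟩ := h x {t} isCompact_singleton (by simpa using ht)
  refine ⟨h1.mono fun s hs => hs t rfl, ?_⟩
  rw [hasDerivWithinAt_iff_isLittleO, Asymptotics.isLittleO_iff]
  intro c hc
  filter_upwards [h2 c hc] with s hs
  have h3 : ‖extChartAt I x ((Γ s).toFun t) - extChartAt I x ((Γ s₀).toFun t)
      - (s - s₀) • V.inChart x t‖ₑ ≤ ENNReal.ofReal (c * |s - s₀|) :=
    (enorm_le_c1NormOn (mem_singleton t) _).trans hs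
  rw [← ofReal_norm, ENNReal.ofReal_le_ofReal_iff (by positivity)] at h3
  exact h3

end Uniqueness

/-! ### Existence and uniqueness of geodesics in the path space. -/

section Geodesics

variable {E : Type*} [NormedAddCommGroup E] [NormedSpace ℝ E]
  {H : Type*} [TopologicalSpace H] {I : ModelWithCorners ℝ E H}
  {N : Type*} [TopologicalSpace N] [ChartedSpace H N] [IsManifold I ∞ N]

/-- The geodesic vector field of a connection, on the tangent bundle. -/
noncomputable def TangentConnection.geodesicField (φ : TangentConnection I N)
    (w : TangentBundle I N) : TangentSpace I.tangent w :=
  φ.toFun w.proj w.2 w.2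

theorem TangentConnection.contMDiff_geodesicField (φ : TangentConnection I N) :
    ContMDiff I.tangent I.tangent.tangent ∞ (fun w =>
      (⟨w, φ.geodesicField w⟩ : TangentBundle I.tangent (TangentBundle I N))) := by
  have h : ContMDiff I.tangent (I.prod 𝓘(ℝ, E × E)) ∞
      (fun w : TangentBundle I N => (⟨w.proj, (w.2, w.2)⟩ : TotalSpace (E × E)
        ((TangentSpace I : N → Type _) ×ᵇ (TangentSpace I : N → Type _)))) := by
    intro w
    have hw := contMDiffAt_totalSpace.1
      (contMDiffAt_id (I := I.tangent) (M := TangentBundle I N) (n := ∞) (x := w))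
    rw [contMDiffAt_totalSpace]
    exact ⟨hw.1, hw.2.prodMk_space hw.2⟩
  exact φ.smooth.comp h

/-- A smooth path in the tangent bundle, seen as a path together with a field along it. -/
def PathSpace.toSigma (w : PathSpace I.tangent (TangentBundle I N)) :
    Σ α : PathSpace I N, PathTangent α :=
  ⟨⟨fun t => (w.toFun t).proj, (contMDiff_proj (TangentSpace I)).comp w.smooth⟩,
    ⟨fun t => (w.toFun t).2, w.smooth⟩⟩

/-- The velocity curves of a geodesic of the induced connection are, for each parameter of the
paths, solutions of the geodesic equation. -/
theorem IsPathGeodesic.exists_solvesInChartsOn {φ : TangentConnection I N} {b : ℝ}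
    {Γ : ℝ → PathSpace I N} {γ : PathSpace I N} {V : PathTangent γ}
    (h : IsPathGeodesic φ b Γ γ V) (t : unitInterval) :
    ∃ w : ℝ → TangentBundle I N, (∀ s, (w s).proj = (Γ s).toFun t) ∧ w 0 = V.toPath.toFun t ∧
      SolvesInChartsOn φ.geodesicField w (Icc 0 b) := by
  obtain ⟨Γ', Γ'', -, h2, h3, h4⟩ := h
  refine ⟨fun s => (Γ' s).toPath.toFun t, fun s => rfl,
    congrArg (fun q : Σ α : PathSpace I N, PathTangent α => q.2.toPath.toFun t) h4, ?_⟩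
  intro s hs x hx
  obtain ⟨h5, h6⟩ := (h2 s hs).hasDerivWithinAt hx
  refine ⟨h5, ?_⟩
  rw [chartField_extChartAt _ hx]
  have h7 : (Γ'' s).toFun t = φ.geodesicField ((Γ' s).toPath.toFun t) := sub_eq_zero.1 (h3 s hs t)
  rw [PathTangent.inChart, h7] at h6
  exact h6

theorem IsPathGeodesic.eq_of_mem_Icc [I.Boundaryless] [T2Space N] {φ : TangentConnection I N}
    {b₁ b₂ : ℝ} {Γ₁ Γ₂ : ℝ → PathSpace I N} {γ : PathSpace I N} {V : PathTangent γ}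
    (h₁ : IsPathGeodesic φ b₁ Γ₁ γ V) (h₂ : IsPathGeodesic φ b₂ Γ₂ γ V) {s : ℝ}
    (hs : s ∈ Icc 0 (min b₁ b₂)) : Γ₁ s = Γ₂ s := by
  have : T2Space (TangentBundle I N) := FiberBundle.t2Space_totalSpace (F := E)
  ext t
  obtain ⟨w₁, hp₁, hi₁, hw₁⟩ := h₁.exists_solvesInChartsOn t
  obtain ⟨w₂, hp₂, hi₂, hw₂⟩ := h₂.exists_solvesInChartsOn t
  have h := SolvesInChartsOn.eqOn_Icc φ.contMDiff_geodesicField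
    (hw₁.mono (Icc_subset_Icc_right (min_le_left b₁ b₂)))
    (hw₂.mono (Icc_subset_Icc_right (min_le_right b₁ b₂))) (hi₁.trans hi₂.symm) hs
  rw [← hp₁ s, ← hp₂ s, h]

theorem TangentConnection.exists_isPathGeodesic [I.Boundaryless] [FiniteDimensional ℝ E]
    [T2Space N] (φ : TangentConnection I N) {γ : PathSpace I N} (V : PathTangent γ) :
    ∃ b : ℝ, 0 < b ∧ ∃ Γ : ℝ → PathSpace I N, IsPathGeodesic φ b Γ γ V := by
  have : T2Space (TangentBundle I N) := FiberBundle.t2Space_totalSpace (F := E)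
  obtain ⟨ε, hε, W, hW0, hW⟩ := exists_flow_along_path φ.contMDiff_geodesicField V.toPath.smooth
  have hsm : ∀ s ∈ Ioo (-ε) ε, ContMDiff (𝓡∂ 1) I.tangent ∞ (W s) := by
    intro s hs t₀
    obtain ⟨v, Φ, hev⟩ := hW t₀
    obtain ⟨hv, hΦ⟩ := hev.self_of_nhds
    have h1 : ContMDiffAt (𝓡∂ 1) 𝓘(ℝ, ℝ × (E × E)) ∞ (fun t => (s, v t)) t₀ :=
      contMDiffAt_const.prodMk_space hv
    refine ((hΦ s hs).1.comp t₀ h1).congr_of_eventuallyEq ?_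
    filter_upwards [hev] with t ht using (ht.2 s hs).2.2
  have hb : 0 < ε / 2 := half_pos hε
  have hmem : ∀ s ∈ Icc 0 (ε / 2), s ∈ Ioo (-ε) ε := fun s hs =>
    ⟨by linarith [hs.1], by linarith [hs.2]⟩
  -- A curve in the path space needs a smooth path at every real time, while `W s` is known to be
  -- smooth only for `|s| < ε`; times are therefore clamped to `[0, ε / 2]`.
  set r : ℝ → ℝ := fun s => projIcc 0 (ε / 2) hb.le s with hr
  have hrm : ∀ s, r s ∈ Ioo (-ε) ε := fun s => hmem _ (projIcc 0 (ε / 2) hb.le s).2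
  have hrs : ∀ s ∈ Icc 0 (ε / 2), r s = s := fun s hs => by
    simp [hr, projIcc_of_mem hb.le hs]
  let w : ℝ → PathSpace I.tangent (TangentBundle I N) := fun s => ⟨W (r s), hsm _ (hrm s)⟩
  refine ⟨ε / 2, hb, fun s => (w s).toSigma.1, fun s => (w s).toSigma.2,
    -- Taking the induced connection itself as second velocity makes the covariant derivative vanish
    -- trivially; the content is that it is the velocity of the velocity curve.
    fun s => φ.induced (w s).toSigma.2 (w s).toSigma.2, ?_, ?_, ?_, ?_⟩
  · intro s₀ hs₀
    refine hasPathVelocity_of_locally_smooth (P := E × E) hs₀ fun t₀ => ?_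
    obtain ⟨v, Φ, hev⟩ := hW t₀
    refine ⟨v, fun z => (Φ z).proj, hev.self_of_nhds.1,
      (contMDiff_proj (TangentSpace I)).contMDiffAt.comp _
        (hev.self_of_nhds.2 s₀ (hmem s₀ hs₀)).1, ?_⟩
    filter_upwards [hev] with t ht
    refine ⟨fun s hs => ?_, ?_⟩
    · change (W (r s) t).proj = _
      rw [hrs s hs, (ht.2 s (hmem s hs)).2.2]
    · obtain ⟨-, h1, h2⟩ := ht.2 s₀ (hmem s₀ hs₀)
      have h3 : MDifferentiableAt I.tangent I (fun p : TangentBundle I N => p.proj)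
          (Φ (s₀, v t)) :=
        (contMDiff_proj (n := ∞) (TangentSpace I)).contMDiffAt.mdifferentiableAt (by simp)
      have h4 := h3.hasMFDerivAt.comp s₀ h1
      have h5 : W (r s₀) t = Φ (s₀, v t) := by rw [hrs s₀ hs₀, h2]
      -- The horizontal lift of `w` at `w` projects to `w`, so the base curve has the flowed vector
      -- as its velocity.
      have h6 : mfderiv I.tangent I (fun p : TangentBundle I N => p.proj) (Φ (s₀, v t))
          (φ.geodesicField (Φ (s₀, v t))) = (Φ (s₀, v t)).2 := φ.mfderiv_proj _ _ _
      refine h4.congr_mfderiv (ContinuousLinearMap.ext_ring ?_)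
      refine (congrArg (mfderiv I.tangent I (fun p : TangentBundle I N => p.proj) (Φ (s₀, v t)))
        (one_smul ℝ (φ.geodesicField (Φ (s₀, v t))))).trans (h6.trans ?_)
      refine Eq.trans ?_ (one_smul ℝ ((W (r s₀) t).2 : E)).symm
      exact congrArg (fun q : TangentBundle I N => (q.2 : E)) h5.symm
  · intro s₀ hs₀
    refine hasPathVelocity_of_locally_smooth (P := E × E) hs₀ fun t₀ => ?_
    obtain ⟨v, Φ, hev⟩ := hW t₀
    refine ⟨v, Φ, hev.self_of_nhds.1, (hev.self_of_nhds.2 s₀ (hmem s₀ hs₀)).1, ?_⟩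
    filter_upwards [hev] with t ht
    refine ⟨fun s hs => ?_, ?_⟩
    · change W (r s) t = _
      rw [hrs s hs, (ht.2 s (hmem s hs)).2.2]
    · obtain ⟨-, h1, h2⟩ := ht.2 s₀ (hmem s₀ hs₀)
      have h5 : W (r s₀) t = Φ (s₀, v t) := by rw [hrs s₀ hs₀, h2]
      exact h1.congr_mfderiv (congrArg (fun q : TangentBundle I N =>
        (1 : ℝ →L[ℝ] ℝ).smulRight (φ.geodesicField q : E × E)) h5.symm)
  · intro s _ t
    exact sub_self _
  · have h0 : w 0 = V.toPath := by
      ext t : 2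
      change W (r 0) t = _
      rw [hrs 0 ⟨le_rfl, hb.le⟩, hW0]
    change (w 0).toSigma = _
    rw [h0]
    rfl

end Geodesics

theorem mainTheorem3 {n : ℕ} {M : Type*} [TopologicalSpace M] [T2Space M]
    [ChartedSpace (EuclideanSpace ℝ (Fin n)) M] [IsManifold (𝓡 n) ∞ M]
    (φ : TangentConnection (𝓡 n) M) (γ : PathSpace (𝓡 n) M) (V : PathTangent γ) :
    (∃ b : ℝ, 0 < b ∧ ∃ Γ : ℝ → PathSpace (𝓡 n) M, IsPathGeodesic φ b Γ γ V) ∧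
    (∀ (b₁ b₂ : ℝ) (Γ₁ Γ₂ : ℝ → PathSpace (𝓡 n) M), 0 < b₁ → 0 < b₂ →
      IsPathGeodesic φ b₁ Γ₁ γ V → IsPathGeodesic φ b₂ Γ₂ γ V →
      ∀ s ∈ Set.Icc 0 (min b₁ b₂), Γ₁ s = Γ₂ s) :=
  ⟨φ.exists_isPathGeodesic V, fun _ _ _ _ _ _ h₁ h₂ _ hs => h₁.eq_of_mem_Icc h₂ hs⟩
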